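/- **Setting.** A network is a connected undirected graph $G=(V,E)$ on $n\ge 2$ nodes whose nodes have distinct identifiers in $\{0,\dots,n^{a}-1\}$ and whose edges have weights in $\{0,1,\dots,n^{a}\}$, where $a$ is a constant. Let $d(u,v)$ be the minimum total weight of a $u$–$v$ path, and let $S$ be the shortest-path diameter: the maximum over all $u,v$ of the minimum number of edges of a $u$–$v$ path of total weight $d(u,v)$. In the CONGEST model, time proceeds in synchronous rounds. In each round every node may send one message of $O(\log n)$ bits through each incident edge. Initially a node knows only $n$, its own identifier, the identifiers of its neighbours, the weights of its incident edges, and its own private random numbers; in particular it does not know $S$. A node that has halted sends nothing and keeps its output. A word can store one identifier or one distance. **Thorup–Zwick sketches.** Let $k\ge 1$. Put $A_0=V$; for $1\le i\le k-1$, every node of $A_{i-1}$ joins $A_i$ independently with probability $n^{-1/k}$; put $A_k=\emptyset$. Distances from a fixed node are compared with ties broken by identifiers, and the distance to the empty set is $\infty$. For a node $u$ and each $0\le i\le k-1$ with $A_i\neq\emptyset$ let $p_i(u)$ be the node of $A_i$ closest to $u$; let $B_i(u)$ be the set of those $w\in A_i$ that are strictly closer to $u$ than every node of $A_{i+1}$,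 and let $B(u)=\bigcup_{i=0}^{k-1}B_i(u)$. The Thorup–Zwick sketch $L(u)$ consists of the nodes $p_i(u)$ and of the nodes of $B(u)$, together with the distances from $u$ to all of them. **Theorem.** For every $k\ge 1$ there is a randomized distributed algorithm in the CONGEST model such that on every network, almost surely, every node $u$ eventually halts with its Thorup–Zwick sketch $L(u)$ as output, where each node decides its membership in the sets $A_i$ by its own private random numbers. Moreover: 1. With high probability all nodes have halted after $O(k\,n^{1/k}\,S\log n)$ rounds, using $O(k\,n^{1/k}\,S\,|E|\log n)$ messages in total, and every sketch $L(u)$ has at most $O(k\,n^{1/k}\log n)$ words. 2. For every node $u$ the expected size of $L(u)$ is $O(k\,n^{1/k})$ words. 3. The sketches have stretch $2k-1$: there is a function $\mathrm{est}$ of two sketches, depending on $k$ only, such that $d(u,v)\le \mathrm{est}(L(u),L(v))\le(2k-1)\,d(u,v)$ for all nodes $u,v$. Here "with high probability" means: for every $c\in\mathbb N$ the algorithm and the constants can be chosen such that the probability is at least $1-n^{-c}$. The constants hidden in the bounds on rounds, messages and sketch sizes depend only on $c$, and the one in the message length only on $a$ and $c$. -/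

import Mathlib

open MeasureTheory

noncomputable section

/-- A weighted communication network on `n` nodes: a connected undirected graph with distinct
node identifiers and nonnegative integral edge weights, all at most polynomial (`n ^ a`) in `n`.
The node names `Fin n` are only used by the mathematical description; the nodes themselves
see identifiers only. -/
structure CongestNetwork (n a : ℕ) where
  graph : SimpleGraph (Fin n)
  connected : graph.Connected
  /-- edge weights; the value at a pair that is not an edge is never used -/
  weight : Sym2 (Fin n) → ℕ
  weight_le : ∀ e ∈ graph.edgeSet, weight e ≤ n ^ a
  id : Fin n → ℕ
  id_injective : Function.Injective id
  id_lt : ∀ v, id v < n ^ a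

namespace CongestNetwork

variable {n a : ℕ} (N : CongestNetwork n a)

/-- Total weight of a walk. -/
def walkWeight {u v : Fin n} (p : N.graph.Walk u v) : ℕ :=
  (p.edges.map N.weight).sum

/-- Weighted distance: the minimum total weight of a simple path (there is one, since the
graph is connected). -/
def wdist (u v : Fin n) : ℕ :=
  sInf {x | ∃ p : N.graph.Walk u v, p.IsPath ∧ N.walkWeight p = x}

/-- The minimum number of hops of a simple path of total weight `N.wdist u v`. -/
def minHops (u v : Fin n) : ℕ :=
  sInf {x | ∃ p : N.graph.Walk u v,
    p.IsPath ∧ N.walkWeight p = N.wdist u v ∧ p.length = x}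

/-- The shortest-path diameter `S`. -/
def shortestPathDiameter : ℕ :=
  Finset.univ.sup fun q : Fin n × Fin n => N.minHops q.1 q.2

/-- The number of edges of the network. -/
def numEdges : ℕ := N.graph.edgeSet.ncard

open Classical in
/-- What a node knows about its incident edges: the identifier of each neighbour is mapped to
the weight of the edge leading to it, every other number is mapped to `none`. -/
def localView (v : Fin n) : ℕ → Option ℕ :=
  Function.extend N.id
    (fun w => if N.graph.Adj v w then some (N.weight s(v, w)) else none)
    (fun _ => none)

end CongestNetwork

/-- A randomized synchronous message-passing algorithm in which all nodes run the same code.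
Every message is a string of `B` bits. The code may depend on whatever is common knowledge, but
a node starts with nothing else than its own identifier, its local view, and
a private sequence of random numbers from `[0,1]`. In each round it may send one message through
each incident edge (addressed by the identifier of the neighbour), and then it updates its state
from the messages that arrive. A node halts as soon as its state has an output. -/
structure CongestAlgorithm (B : ℕ) (Out : Type) where
  State : Type
  init : (ownId : ℕ) → (view : ℕ → Option ℕ) → (coins : ℕ → unitInterval) → State
  send : State → (receiver : ℕ) → Option (BitVec B)
  receive : State → (inbox : ℕ → Option (BitVec B)) → State
  output : State → Option Out

namespace CongestAlgorithm

variable {n a B : ℕ} {Out : Type} (alg : CongestAlgorithm B Out) (N : CongestNetwork n a)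

open Classical in
/-- The message sent from `v` to `w` in a round that starts in the configuration `σ`. Messages
travel along edges only, and a node that has halted sends nothing. -/
def sent (σ : Fin n → alg.State) (v w : Fin n) : Option (BitVec B) :=
  if N.graph.Adj v w ∧ alg.output (σ v) = none then alg.send (σ v) (N.id w) else none

/-- The messages that arrive at `v` in this round, indexed by the identifier of the sender. -/
def inbox (σ : Fin n → alg.State) (v : Fin n) : ℕ → Option (BitVec B) :=
  Function.extend N.id (fun w => alg.sent N σ w v) (fun _ => none)

open Classical in
/-- One synchronous round. A node that has halted keeps its state. -/
def round (σ : Fin n → alg.State) : Fin n → alg.State := fun v =>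
  if alg.output (σ v) = none then alg.receive (σ v) (alg.inbox N σ v) else σ v

/-- The configuration after `t` rounds, where `ω (v, j)` is the `j`-th random number of the
node `v`. -/
def config (ω : Fin n × ℕ → unitInterval) : ℕ → Fin n → alg.State
  | 0 => fun v => alg.init (N.id v) (N.localView v) (fun j => ω (v, j))
  | t + 1 => alg.round N (config ω t)

/-- The output of `v` after `t` rounds (`none` if `v` has not halted yet). -/
def outputAt (ω : Fin n × ℕ → unitInterval) (t : ℕ) (v : Fin n) : Option Out :=
  alg.output (alg.config N ω t v)

open Classical in
/-- The number of messages that are sent in the first `t` rounds. -/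
def messagesUpTo (ω : Fin n × ℕ → unitInterval) (t : ℕ) : ℕ :=
  ∑ s ∈ Finset.range t,
    (Finset.univ.filter fun q : Fin n × Fin n =>
      (alg.sent N (alg.config N ω s) q.1 q.2).isSome).card

end CongestAlgorithm

/-- The law of the random numbers: all numbers of all nodes are independent and uniform
on `[0,1]`. -/
def coinLaw (n : ℕ) : Measure (Fin n × ℕ → unitInterval) :=
  Measure.infinitePi fun _ => (volume : Measure unitInterval)

/-- The sketch format. An entry is a pair (distance, identifier), i.e. two words; entries are
ordered lexicographically, which is comparison by distance with ties broken by identifier.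
`pivot i` is `⊤` if there is no pivot at level `i`. -/
@[ext]
structure DistSketch (k : ℕ) where
  pivot : Fin k → WithTop (ℕ ×ₗ ℕ)
  bunch : Finset (ℕ ×ₗ ℕ)

open Classical in
/-- The size of a sketch in words: each entry takes one word for the node identifier and one word
for the distance. -/
def DistSketch.words {k : ℕ} (L : DistSketch k) : ℕ :=
  2 * (Finset.univ.filter fun i => L.pivot i ≠ ⊤).card + 2 * L.bunch.card

open Classical in
/-- The random hierarchy of `k` levels: `A 0` consists of all nodes, a node of `A i` joins
`A (i + 1)`, for `i + 1 < k`, iff its `i`-th random number is at most `n ^ (-1 / k)`, and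
`A i` is empty for `i ≥ k`. -/
def tzHierarchy (n k : ℕ) (ω : Fin n × ℕ → unitInterval) (i : ℕ) : Finset (Fin n) :=
  if i < k then
    Finset.univ.filter fun v => ∀ j < i, (ω (v, j) : ℝ) ≤ (n : ℝ) ^ (-(1 / (k : ℝ)))
  else ∅

namespace CongestNetwork

variable {n a : ℕ} (N : CongestNetwork n a)

/-- The entries (distance from `u`, identifier) of the nodes of `A`. -/
def entries (u : Fin n) (A : Finset (Fin n)) : Finset (ℕ ×ₗ ℕ) :=
  A.image fun w => toLex (N.wdist u w, N.id w)

open Classical in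
/-- The entries of those nodes of `A` that are strictly closer to `u` than every node of `A'`
(all of `A` if `A'` is empty, the distance to the empty set being infinite). -/
def closerEntries (u : Fin n) (A A' : Finset (Fin n)) : Finset (ℕ ×ₗ ℕ) :=
  (N.entries u A).filter fun x => (x : WithTop (ℕ ×ₗ ℕ)) < (N.entries u A').min

/-- The Thorup-Zwick label of the node `u` for the hierarchy `tzHierarchy n k ω`: for each level
the node of that level nearest to `u`, and the bunch of `u`, which is the union of the
level-`i` bunches for `i < k`, together with the distances from `u` to all these nodes. -/
def tzLabel (k : ℕ) (ω : Fin n × ℕ → unitInterval) (u : Fin n) : DistSketch k where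
  pivot i := (N.entries u (tzHierarchy n k ω i)).min
  bunch := (Finset.range k).biUnion fun i =>
    N.closerEntries u (tzHierarchy n k ω i) (tzHierarchy n k ω (i + 1))

end CongestNetwork

end

/-!
The algorithm is Bellman–Ford with pruned tables. Call the last `i < k` with `w ∈ A i` the level
of `w`. An entry (level, distance, identifier) makes another one superfluous if it is at least as
close and either has a higher level or stands for the same node; this is a partial order on
entries, and the Thorup–Zwick label of `u` is the set of minimal elements (the front, `prune`) of
the entries of all nodes with their distances from `u` (`sketchOf_prune_distEntries`). Since the
order is invariant under adding an edge weight, pruning commutes with the Bellman–Ford recursion: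
if every node starts a stage with the front of the walks with at most `r` edges, and all nodes send
these fronts to their neighbours, then they obtain the fronts for `r + 1` edges
(`stage_fst_eq_prune_walkEntries`). After `S` stages these are the labels.

The nodes do not know `S`. Each node keeps the number `l` of the last stage from which it has
heard that a table changed or a message got lost, and halts after `3 * l + 2` stages. Then
all nodes at most `2 * l + 1` edges away were quiet in stage `l`. An entry of the highest level
among their tables cannot be pruned, so it has spread over this whole ball, and as it travels one
edge per stage, the ball has diameter at most `2 * l`; hence it is the whole network
(`exists_walk_of_quiet`). So the tables are a fixed point of the recursion, they are correct, and
all nodes halt together (`stopped_and_correct`).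

A stage takes `K = O(k * n ^ (1 / k) * log n)` rounds, which suffices to send a table with `K`
entries: the number of such tables is at most `3 ^ k` times the `K`-th power of a polynomial in `n`
(`card_powerset_filter_card_le`), so they can be numbered by `K` messages of `O(log n)` bits,
even if `k` is far larger than `n`. A larger table gets lost. For fixed `r` and `u`, the order in
which `u` sees the other nodes along walks with at most `r` edges does not depend on the random
numbers; therefore each level of the front has a geometric tail (`coinLaw_le_card_leading`),
respectively a binomial one for the last level (`coinLaw_le_card_survivors`), and with high
probability no table ever gets lost (`coinLaw_not_small_fronts`). To be correct in any case, from
stage `3 * n + 3` on the stages last `n` rounds longer, so that every table can be sent, and the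
recursion converges from whatever tables it finds (`stopped_of_large_phases`).

The stretch bound is the argument of Thorup and Zwick (`exists_common_mem`).
-/

noncomputable section

/-! ### Table entries and their Pareto order -/

/-- What a node knows about some node `w`: the level of `w` (the last index `i` with `w ∈ A i`),
the weight of some walk to `w`, and the identifier of `w`. -/
@[ext]
structure TZEntry where
  level : ℕ
  dist : ℕ
  id : ℕ

namespace TZEntry

/-- The sketch entry of a table entry. -/
def key (e : TZEntry) : ℕ ×ₗ ℕ := toLex (e.dist, e.id)

/-- The entry as seen by a neighbour, along an edge of weight `c`. -/
def shift (c : ℕ) (e : TZEntry) : TZEntry := ⟨e.level, e.dist + c, e.id⟩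

theorem key_le_key_iff {e f : TZEntry} :
    e.key ≤ f.key ↔ e.dist < f.dist ∨ (e.dist = f.dist ∧ e.id ≤ f.id) := by
  simp [key, Prod.Lex.toLex_le_toLex]

/-- `e ≤ f` means that `e` makes `f` superfluous: it is at least as close (with ties broken by
identifiers), and it has a higher level or stands for the same node. -/
instance : PartialOrder TZEntry where
  le e f := e.key ≤ f.key ∧ (f.level < e.level ∨ (e.level = f.level ∧ e.id = f.id))
  le_refl e := ⟨le_rfl, Or.inr ⟨rfl, rfl⟩⟩
  le_trans e f g h₁ h₂ := ⟨h₁.1.trans h₂.1, by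
    obtain ⟨-, h₁⟩ := h₁
    obtain ⟨-, h₂⟩ := h₂
    omega⟩
  le_antisymm e f h₁ h₂ := by
    obtain ⟨h₁, h₁'⟩ := h₁
    obtain ⟨h₂, h₂'⟩ := h₂
    rw [key_le_key_iff] at h₁ h₂
    ext <;> omega

theorem le_def {e f : TZEntry} :
    e ≤ f ↔ e.key ≤ f.key ∧ (f.level < e.level ∨ (e.level = f.level ∧ e.id = f.id)) := Iff.rfl

theorem level_le_of_le {e f : TZEntry} (h : e ≤ f) : f.level ≤ e.level := by
  have := h.2
  omega

theorem shift_le_shift (c : ℕ) {e f : TZEntry} (h : e ≤ f) : e.shift c ≤ f.shift c := by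
  rw [le_def, key_le_key_iff] at *
  simp only [shift]
  omega

end TZEntry

open Classical in
/-- The Pareto front of a table: the entries that no other entry makes superfluous. -/
def prune (T : Finset TZEntry) : Finset TZEntry := T.filter fun e => Minimal (· ∈ T) e

/-- Every entry of `B` is made superfluous by some entry of `A`. -/
def Covers (A B : Finset TZEntry) : Prop := ∀ b ∈ B, ∃ a ∈ A, a ≤ b

theorem Covers.trans {A B C : Finset TZEntry} (h : Covers A B) (h' : Covers B C) :
    Covers A C := fun c hc =>
  let ⟨b, hb, hbc⟩ := h' c hc
  let ⟨a, ha, hab⟩ := h b hb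
  ⟨a, ha, hab.trans hbc⟩

theorem covers_of_subset {A B : Finset TZEntry} (h : B ⊆ A) : Covers A B :=
  fun b hb => ⟨b, h hb, le_rfl⟩

theorem prune_subset (T : Finset TZEntry) : prune T ⊆ T := by
  classical
  exact Finset.filter_subset _ _

theorem mem_prune {T : Finset TZEntry} {e : TZEntry} :
    e ∈ prune T ↔ e ∈ T ∧ ∀ f ∈ T, f ≤ e → f = e := by
  classical
  simp only [prune, Finset.mem_filter]
  refine and_congr_right fun he => ⟨fun h f hf hfe => le_antisymm hfe (h.2 hf hfe),
    fun h => ⟨he, fun f hf hfe => (h f hf hfe).ge⟩⟩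

theorem prune_covers (T : Finset TZEntry) : Covers (prune T) T := by
  classical
  intro b hb
  obtain ⟨a, hab, ha⟩ := T.exists_le_minimal hb
  exact ⟨a, Finset.mem_filter.2 ⟨ha.1, ha⟩, hab⟩

theorem prune_eq_of_covers {A B : Finset TZEntry} (h : Covers A B) (h' : Covers B A) :
    prune A = prune B := by
  suffices H : ∀ {A B : Finset TZEntry}, Covers A B → Covers B A → prune A ⊆ prune B from
    (H h h').antisymm (H h' h)
  clear h h' A B
  intro A B h h' e he
  rw [mem_prune] at he ⊢
  obtain ⟨heA, hmin⟩ := he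
  have key : ∀ f ∈ B, f ≤ e → f = e := fun f hf hfe => by
    obtain ⟨g, hg, hgf⟩ := h f hf
    have := hmin g hg (hgf.trans hfe)
    exact le_antisymm hfe (this ▸ hgf)
  obtain ⟨b, hb, hbe⟩ := h' e heA
  exact ⟨key b hb hbe ▸ hb, key⟩

theorem prune_prune (T : Finset TZEntry) : prune (prune T) = prune T :=
  prune_eq_of_covers (prune_covers T) (covers_of_subset (prune_subset T))

/-! ### Weighted distances -/

namespace CongestNetwork

variable {n a : ℕ} (N : CongestNetwork n a)

theorem walkWeight_nil {u : Fin n} : N.walkWeight (SimpleGraph.Walk.nil : N.graph.Walk u u) = 0 :=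
  rfl

theorem walkWeight_cons {u v w : Fin n} (h : N.graph.Adj u v) (p : N.graph.Walk v w) :
    N.walkWeight (.cons h p) = N.weight s(u, v) + N.walkWeight p := by
  simp [walkWeight]

theorem walkWeight_append {u v w : Fin n} (p : N.graph.Walk u v) (q : N.graph.Walk v w) :
    N.walkWeight (p.append q) = N.walkWeight p + N.walkWeight q := by
  simp [walkWeight, SimpleGraph.Walk.edges_append]

theorem walkWeight_reverse {u v : Fin n} (p : N.graph.Walk u v) :
    N.walkWeight p.reverse = N.walkWeight p := by
  simp [walkWeight, SimpleGraph.Walk.edges_reverse, List.sum_reverse]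

open Classical in
theorem walkWeight_bypass_le {u v : Fin n} (p : N.graph.Walk u v) :
    N.walkWeight p.bypass ≤ N.walkWeight p := by
  refine List.Sublist.sum_le_sum (List.Sublist.map _ ?_) (fun _ _ => Nat.zero_le _)
  exact p.edges_bypass_sublist_edges

theorem walkWeight_le {u v : Fin n} (p : N.graph.Walk u v) :
    N.walkWeight p ≤ p.length * n ^ a := by
  induction p with
  | nil => simp [walkWeight_nil]
  | cons h p ih =>
    rw [walkWeight_cons, SimpleGraph.Walk.length_cons, add_mul, one_mul, add_comm]
    exact add_le_add ih (N.weight_le _ h)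

theorem wdist_le_walkWeight {u v : Fin n} (p : N.graph.Walk u v) :
    N.wdist u v ≤ N.walkWeight p := by
  classical
  exact le_trans (Nat.sInf_le ⟨p.bypass, p.bypass_isPath, rfl⟩) (N.walkWeight_bypass_le p)

theorem exists_isPath_walkWeight_eq (u v : Fin n) :
    ∃ p : N.graph.Walk u v, p.IsPath ∧ N.walkWeight p = N.wdist u v := by
  classical
  obtain ⟨p⟩ := N.connected.preconnected u v
  exact Nat.sInf_mem (s := {x | ∃ p : N.graph.Walk u v, p.IsPath ∧ N.walkWeight p = x})
    ⟨_, p.bypass, p.bypass_isPath, rfl⟩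

theorem exists_walk_length_eq_minHops (u v : Fin n) :
    ∃ p : N.graph.Walk u v, p.IsPath ∧ N.walkWeight p = N.wdist u v ∧
      p.length = N.minHops u v := by
  obtain ⟨p, hp, hw⟩ := N.exists_isPath_walkWeight_eq u v
  exact Nat.sInf_mem (s := {x | ∃ p : N.graph.Walk u v,
    p.IsPath ∧ N.walkWeight p = N.wdist u v ∧ p.length = x}) ⟨_, p, hp, hw, rfl⟩

theorem minHops_le_shortestPathDiameter (u v : Fin n) :
    N.minHops u v ≤ N.shortestPathDiameter :=
  Finset.le_sup (f := fun q : Fin n × Fin n => N.minHops q.1 q.2) (Finset.mem_univ (u, v))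

theorem shortestPathDiameter_le : N.shortestPathDiameter ≤ n := by
  refine Finset.sup_le fun q _ => ?_
  obtain ⟨p, hp, -, hl⟩ := N.exists_walk_length_eq_minHops q.1 q.2
  have := hp.length_lt
  simp only [Fintype.card_fin] at this
  omega

theorem shortestPathDiameter_pos (hn : 2 ≤ n) : 0 < N.shortestPathDiameter := by
  let u : Fin n := ⟨0, by omega⟩
  let v : Fin n := ⟨1, by omega⟩
  refine lt_of_lt_of_le ?_ (N.minHops_le_shortestPathDiameter u v)
  obtain ⟨p, -, -, hl⟩ := N.exists_walk_length_eq_minHops u v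
  rw [← hl, Nat.pos_iff_ne_zero]
  intro h
  have := congrArg Fin.val (SimpleGraph.Walk.eq_of_length_eq_zero h)
  simp [u, v] at this

theorem wdist_self (u : Fin n) : N.wdist u u = 0 :=
  Nat.le_zero.1 (N.wdist_le_walkWeight SimpleGraph.Walk.nil)

theorem wdist_comm (u v : Fin n) : N.wdist u v = N.wdist v u := by
  have H : ∀ u v, N.wdist u v ≤ N.wdist v u := fun u v => by
    obtain ⟨p, -, hw⟩ := N.exists_isPath_walkWeight_eq v u
    rw [← hw, ← N.walkWeight_reverse]
    exact N.wdist_le_walkWeight _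
  exact (H u v).antisymm (H v u)

theorem wdist_triangle (u v w : Fin n) : N.wdist u w ≤ N.wdist u v + N.wdist v w := by
  obtain ⟨p, -, hp⟩ := N.exists_isPath_walkWeight_eq u v
  obtain ⟨q, -, hq⟩ := N.exists_isPath_walkWeight_eq v w
  rw [← hp, ← hq, ← N.walkWeight_append]
  exact N.wdist_le_walkWeight _

theorem exists_adj (hn : 2 ≤ n) (v : Fin n) : ∃ w, N.graph.Adj v w := by
  have : Nontrivial (Fin n) := Fin.nontrivial_iff_two_le.2 hn
  exact N.connected.preconnected.exists_adj_of_nontrivial v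

/-! ### Relaxation of distance tables -/

variable (lv : Fin n → ℕ)

/-- The entry of the node `v` in its own table; `lv` gives the levels of the nodes. -/
def ownEntry (v : Fin n) : TZEntry := ⟨lv v, 0, N.id v⟩

open Classical in
/-- What the node `v` learns from the tables `X w` of its neighbours `w`. -/
def relax (X : Fin n → Finset TZEntry) (v : Fin n) : Finset TZEntry :=
  insert (N.ownEntry lv v) ((Finset.univ.filter fun w => N.graph.Adj v w).biUnion fun w =>
    (X w).image (TZEntry.shift (N.weight s(v, w))))

variable {lv}

theorem mem_relax {X : Fin n → Finset TZEntry} {v : Fin n} {e : TZEntry} :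
    e ∈ N.relax lv X v ↔ e = N.ownEntry lv v ∨
      ∃ w, N.graph.Adj v w ∧ ∃ f ∈ X w, f.shift (N.weight s(v, w)) = e := by
  classical
  simp [relax]

theorem relax_covers {X Y : Fin n → Finset TZEntry} (h : ∀ v, Covers (X v) (Y v)) (v : Fin n) :
    Covers (N.relax lv X v) (N.relax lv Y v) := by
  intro e he
  rw [mem_relax] at he
  rcases he with rfl | ⟨w, hw, f, hf, rfl⟩
  · exact ⟨_, N.mem_relax.2 (Or.inl rfl), le_rfl⟩
  · obtain ⟨g, hg, hgf⟩ := h w f hf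
    exact ⟨_, N.mem_relax.2 (Or.inr ⟨w, hw, g, hg, rfl⟩), TZEntry.shift_le_shift _ hgf⟩

variable (lv)

/-- The entries of all walks with at most `r` edges that start at `v`. -/
def walkEntries : ℕ → Fin n → Finset TZEntry
  | 0 => fun v => {N.ownEntry lv v}
  | r + 1 => N.relax lv (walkEntries r)

/-- The entries of the shortest paths that start at `v`. -/
def distEntries (v : Fin n) : Finset TZEntry :=
  Finset.univ.map ⟨fun w => ⟨lv w, N.wdist v w, N.id w⟩, fun _ _ h =>
    N.id_injective (congrArg TZEntry.id h)⟩

variable {lv}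

theorem mem_walkEntries {r : ℕ} {v : Fin n} {e : TZEntry} :
    e ∈ N.walkEntries lv r v ↔ ∃ (w : Fin n) (p : N.graph.Walk v w),
      p.length ≤ r ∧ e = ⟨lv w, N.walkWeight p, N.id w⟩ := by
  induction r generalizing v e with
  | zero =>
    simp only [walkEntries, Finset.mem_singleton, Nat.le_zero]
    constructor
    · rintro rfl
      exact ⟨v, .nil, rfl, rfl⟩
    · rintro ⟨w, p, hp, rfl⟩
      cases p with
      | nil => rfl
      | cons h p => simp at hp
  | succ r ih =>
    rw [walkEntries, mem_relax]
    constructor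
    · rintro (rfl | ⟨w, hw, f, hf, rfl⟩)
      · exact ⟨v, .nil, Nat.zero_le _, rfl⟩
      · obtain ⟨x, p, hp, rfl⟩ := ih.1 hf
        refine ⟨x, .cons hw p, by simpa using hp, ?_⟩
        simp [TZEntry.shift, walkWeight_cons, add_comm]
    · rintro ⟨x, p, hp, rfl⟩
      cases p with
      | nil => exact Or.inl rfl
      | cons h p =>
        refine Or.inr ⟨_, h, _, ih.2 ⟨x, p, by simpa using hp, rfl⟩, ?_⟩
        simp [TZEntry.shift, walkWeight_cons, add_comm]

theorem mem_distEntries {v : Fin n} {e : TZEntry} :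
    e ∈ N.distEntries lv v ↔ ∃ w, e = ⟨lv w, N.wdist v w, N.id w⟩ := by
  rw [distEntries, Finset.mem_map]
  exact ⟨fun ⟨w, _, h⟩ => ⟨w, h.symm⟩, fun ⟨w, h⟩ => ⟨w, Finset.mem_univ w, h.symm⟩⟩

theorem walkEntries_mono {r s : ℕ} (h : r ≤ s) (v : Fin n) :
    N.walkEntries lv r v ⊆ N.walkEntries lv s v := fun e he => by
  rw [mem_walkEntries] at *
  obtain ⟨w, p, hp, rfl⟩ := he
  exact ⟨w, p, hp.trans h, rfl⟩

theorem distEntries_covers_walkEntries (r : ℕ) (v : Fin n) :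
    Covers (N.distEntries lv v) (N.walkEntries lv r v) := by
  intro e he
  obtain ⟨w, p, -, rfl⟩ := N.mem_walkEntries.1 he
  refine ⟨_, N.mem_distEntries.2 ⟨w, rfl⟩, ?_, Or.inr ⟨rfl, rfl⟩⟩
  have := N.wdist_le_walkWeight p
  rw [TZEntry.key_le_key_iff]
  dsimp only
  omega

theorem walkEntries_covers_distEntries {r : ℕ} (hr : N.shortestPathDiameter ≤ r) (v : Fin n) :
    Covers (N.walkEntries lv r v) (N.distEntries lv v) := by
  intro e he
  obtain ⟨w, rfl⟩ := N.mem_distEntries.1 he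
  obtain ⟨p, -, hw, hl⟩ := N.exists_walk_length_eq_minHops v w
  refine ⟨_, N.mem_walkEntries.2 ⟨w, p, ?_, rfl⟩, by rw [hw]⟩
  exact (hl.trans_le (N.minHops_le_shortestPathDiameter v w)).trans hr

end CongestNetwork

/-! ### Labels as Pareto fronts -/

open Classical in
/-- The level of a node with the given random numbers: the last `i < k` such that the node belongs
to `A i`. -/
def tzLevel (n k : ℕ) (coins : ℕ → unitInterval) : ℕ :=
  Nat.findGreatest (fun i => ∀ j < i, (coins j : ℝ) ≤ (n : ℝ) ^ (-(1 / (k : ℝ)))) (k - 1)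

theorem tzLevel_lt {n k : ℕ} (hk : 1 ≤ k) (coins : ℕ → unitInterval) : tzLevel n k coins < k := by
  classical
  have := Nat.findGreatest_le (P := fun i => ∀ j < i, (coins j : ℝ) ≤ (n : ℝ) ^ (-(1 / (k : ℝ))))
    (k - 1)
  unfold tzLevel
  omega

theorem mem_tzHierarchy {n k : ℕ} {ω : Fin n × ℕ → unitInterval} {i : ℕ} {v : Fin n} :
    v ∈ tzHierarchy n k ω i ↔ i < k ∧ i ≤ tzLevel n k fun j => ω (v, j) := by
  classical
  unfold tzHierarchy
  split_ifs with h
  · rw [Finset.mem_filter, tzLevel]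
    constructor
    · exact fun h' => ⟨h, Nat.le_findGreatest (by omega) h'.2⟩
    · rintro ⟨-, h'⟩
      refine ⟨Finset.mem_univ _, fun j hj => ?_⟩
      exact Nat.findGreatest_spec
        (P := fun i => ∀ j < i, (ω (v, j) : ℝ) ≤ (n : ℝ) ^ (-(1 / (k : ℝ))))
        (Nat.zero_le (k - 1)) (fun _ h => absurd h (Nat.not_lt_zero _)) j (hj.trans_le h')
  · simp [h]

open Classical in
/-- The sketch that is read off from a Pareto front. -/
def sketchOf (k : ℕ) (T : Finset TZEntry) : DistSketch k where
  pivot i := ((T.filter fun e => (i : ℕ) ≤ e.level).image TZEntry.key).min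
  bunch := T.image TZEntry.key

theorem Finset.coe_lt_min_iff {α : Type*} [LinearOrder α] {s : Finset α} {x : α} :
    (x : WithTop α) < s.min ↔ ∀ y ∈ s, x < y := by
  constructor
  · exact fun h y hy => WithTop.coe_lt_coe.1 (h.trans_le (Finset.min_le hy))
  · intro h
    cases hm : s.min with
    | top => exact WithTop.coe_lt_top x
    | coe y => exact WithTop.coe_lt_coe.2 (h y (Finset.mem_of_min hm))

namespace CongestNetwork

variable {n a : ℕ} (N : CongestNetwork n a)

theorem mem_entries {u : Fin n} {A : Finset (Fin n)} {x : ℕ ×ₗ ℕ} :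
    x ∈ N.entries u A ↔ ∃ w ∈ A, toLex (N.wdist u w, N.id w) = x := by
  simp [entries]

theorem mem_closerEntries {u : Fin n} {A A' : Finset (Fin n)} {x : ℕ ×ₗ ℕ} :
    x ∈ N.closerEntries u A A' ↔ ∃ w ∈ A, toLex (N.wdist u w, N.id w) = x ∧
      ∀ w' ∈ A', x < toLex (N.wdist u w', N.id w') := by
  classical
  rw [closerEntries, Finset.mem_filter, Finset.coe_lt_min_iff, mem_entries]
  simp only [mem_entries, forall_exists_index, and_imp, forall_apply_eq_imp_iff₂]
  exact ⟨fun ⟨⟨w, hw, h⟩, h'⟩ => ⟨w, hw, h, h'⟩, fun ⟨w, hw, h, h'⟩ => ⟨⟨w, hw, h⟩, h'⟩⟩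

/-- The Pareto front of the exact distance entries is the Thorup–Zwick label. -/
theorem sketchOf_prune_distEntries {k : ℕ} (hk : 1 ≤ k) (ω : Fin n × ℕ → unitInterval)
    (u : Fin n) :
    sketchOf k (prune (N.distEntries (fun v => tzLevel n k fun j => ω (v, j)) u)) =
      N.tzLabel k ω u := by
  classical
  set lv : Fin n → ℕ := fun v => tzLevel n k fun j => ω (v, j) with hlv
  have hlt : ∀ v, lv v < k := fun v => tzLevel_lt hk _
  have hA : ∀ i v, v ∈ tzHierarchy n k ω i ↔ i < k ∧ i ≤ lv v := fun i v => mem_tzHierarchy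
  ext1
  · funext i
    simp only [sketchOf, tzLabel]
    apply le_antisymm
    · refine Finset.le_min fun x hx => ?_
      obtain ⟨w, hw, rfl⟩ := N.mem_entries.1 hx
      obtain ⟨e, he, hle⟩ := prune_covers (N.distEntries lv u) _ (N.mem_distEntries.2 ⟨w, rfl⟩)
      refine (Finset.min_le (Finset.mem_image_of_mem _ (Finset.mem_filter.2 ⟨he, ?_⟩))).trans
        (WithTop.coe_le_coe.2 hle.1)
      exact ((hA _ _).1 hw).2.trans (TZEntry.level_le_of_le hle)
    · refine Finset.le_min fun x hx => ?_
      obtain ⟨e, he, rfl⟩ := Finset.mem_image.1 hx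
      obtain ⟨he, hi⟩ := Finset.mem_filter.1 he
      obtain ⟨w, rfl⟩ := N.mem_distEntries.1 (prune_subset _ he)
      exact Finset.min_le (N.mem_entries.2 ⟨w, (hA _ _).2 ⟨i.2, hi⟩, rfl⟩)
  · ext x
    simp only [sketchOf, tzLabel, Finset.mem_image, Finset.mem_biUnion, Finset.mem_range,
      mem_closerEntries, mem_prune]
    constructor
    · rintro ⟨e, ⟨he, hmin⟩, rfl⟩
      obtain ⟨w, rfl⟩ := N.mem_distEntries.1 he
      refine ⟨lv w, hlt w, w, (hA _ _).2 ⟨hlt w, le_rfl⟩, rfl, fun w' hw' => ?_⟩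
      by_contra hcon
      have hw' := ((hA _ _).1 hw').2
      have := congrArg TZEntry.level
        (hmin _ (N.mem_distEntries.2 ⟨w', rfl⟩) ⟨not_lt.1 hcon, Or.inl hw'⟩)
      dsimp only at this
      omega
    · rintro ⟨i, hi, w, hw, rfl, hlt'⟩
      have hwi : lv w ≤ i := by
        by_contra hcon
        refine lt_irrefl _ (hlt' w ((hA _ _).2 ⟨?_, by omega⟩))
        have := hlt w
        omega
      refine ⟨⟨lv w, N.wdist u w, N.id w⟩, ⟨N.mem_distEntries.2 ⟨w, rfl⟩, fun f hf hle => ?_⟩, rfl⟩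
      obtain ⟨w', rfl⟩ := N.mem_distEntries.1 hf
      rcases hle.2 with h | h
      · refine absurd hle.1 (not_le.2 (hlt' w' ((hA _ _).2 ⟨?_, ?_⟩)))
        · have := hlt w'
          dsimp only at h
          have := ((hA _ _).1 hw).2
          omega
        · dsimp only at h
          have := ((hA _ _).1 hw).2
          omega
      · rw [N.id_injective h.2]

end CongestNetwork

/-! ### Pruned Bellman–Ford with distributed termination detection -/

namespace CongestNetwork

variable {n a : ℕ} (N : CongestNetwork n a)

open Classical in
/-- Pruned Bellman–Ford, in stages: the table of each node after `j` stages, together with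
the number of the last stage known to the node in which something was still going on, that is, in
which the table of some node changed or some node missed a message. In stage `j` the nodes tell
their neighbours table and number if `ok j` holds for this pair (a pair that is too large cannot be
sent). -/
def stage (lv : Fin n → ℕ) (ok : ℕ → Finset TZEntry × ℕ → Prop) :
    ℕ → Fin n → Finset TZEntry × ℕ
  | 0 => fun v => ({N.ownEntry lv v}, 0)
  | j + 1 => fun v =>
    let X := stage lv ok j
    let T := prune (N.relax lv (fun w => if ok j (X w) then (X w).1 else ∅) v)
    (T, if T = (X v).1 ∧ ∀ w, N.graph.Adj v w → ok j (X w) then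
        max (X v).2 ((Finset.univ.filter fun w => N.graph.Adj v w).sup fun w => (X w).2)
      else j + 1)

/-- The halting criterion: after `l` stages everything was quiet, and the silence has lasted
long enough for bad news to arrive from distance `2 * l + 1`. -/
def Stopped (lv : Fin n → ℕ) (ok : ℕ → Finset TZEntry × ℕ → Prop) (j : ℕ) (v : Fin n) : Prop :=
  3 * (N.stage lv ok j v).2 + 2 ≤ j

variable {N} {lv : Fin n → ℕ} {ok : ℕ → Finset TZEntry × ℕ → Prop}

theorem stage_succ_fst (j : ℕ) (v : Fin n) : (N.stage lv ok (j + 1) v).1 =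
    prune (N.relax lv (fun w => open Classical in
      if ok j (N.stage lv ok j w) then (N.stage lv ok j w).1 else ∅) v) := rfl

/-- In stage `j` the node `v` receives all messages, and its table does not change. -/
def Quiet (N : CongestNetwork n a) (lv : Fin n → ℕ) (ok : ℕ → Finset TZEntry × ℕ → Prop)
    (j : ℕ) (v : Fin n) : Prop :=
  (N.stage lv ok (j + 1) v).1 = (N.stage lv ok j v).1 ∧
    ∀ w, N.graph.Adj v w → ok j (N.stage lv ok j w)

open Classical in
theorem stage_succ_snd (j : ℕ) (v : Fin n) : (N.stage lv ok (j + 1) v).2 =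
    if N.Quiet lv ok j v then max (N.stage lv ok j v).2
      ((Finset.univ.filter fun w => N.graph.Adj v w).sup fun w => (N.stage lv ok j w).2)
    else j + 1 := by
  rw [stage]
  exact if_congr Iff.rfl rfl rfl

theorem stage_snd_le (j : ℕ) (v : Fin n) : (N.stage lv ok j v).2 ≤ j := by
  classical
  induction j generalizing v with
  | zero => exact le_rfl
  | succ j ih =>
    rw [stage_succ_snd]
    split_ifs
    · exact max_le ((ih v).trans (Nat.le_succ j))
        (Finset.sup_le fun w _ => (ih w).trans (Nat.le_succ j))
    · exact le_rfl

theorem stage_snd_le_succ (j : ℕ) (v : Fin n) :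
    (N.stage lv ok j v).2 ≤ (N.stage lv ok (j + 1) v).2 := by
  classical
  rw [stage_succ_snd]
  split_ifs
  · exact le_max_left _ _
  · exact (stage_snd_le j v).trans (Nat.le_succ j)

theorem stage_snd_mono {i j : ℕ} (h : i ≤ j) (v : Fin n) :
    (N.stage lv ok i v).2 ≤ (N.stage lv ok j v).2 :=
  monotone_nat_of_le_succ (f := fun j => (N.stage lv ok j v).2) (fun j => stage_snd_le_succ j v) h

theorem stage_snd_le_of_adj (j : ℕ) {v w : Fin n} (h : N.graph.Adj v w) :
    (N.stage lv ok j w).2 ≤ (N.stage lv ok (j + 1) v).2 := by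
  classical
  rw [stage_succ_snd]
  split_ifs
  · exact le_max_of_le_right (Finset.le_sup (f := fun w => (N.stage lv ok j w).2)
      (Finset.mem_filter.2 ⟨Finset.mem_univ w, h⟩))
  · exact (stage_snd_le j w).trans (Nat.le_succ j)

theorem quiet_of_stage_snd_le {j : ℕ} {v : Fin n} (h : (N.stage lv ok (j + 1) v).2 ≤ j) :
    N.Quiet lv ok j v := by
  classical
  rw [stage_succ_snd] at h
  split_ifs at h with hq
  · exact hq
  · omega

/-- News travel by one edge per stage. -/
theorem stage_snd_le_of_walk {u v : Fin n} (p : N.graph.Walk u v) (j : ℕ) :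
    (N.stage lv ok j v).2 ≤ (N.stage lv ok (j + p.length) u).2 := by
  induction p with
  | nil => exact le_rfl
  | cons h p ih =>
    rw [SimpleGraph.Walk.length_cons, ← add_assoc]
    exact ih.trans (stage_snd_le_of_adj _ h)

theorem relax_congr_of_quiet {j : ℕ} {v : Fin n} (h : N.Quiet lv ok j v) :
    (N.stage lv ok j v).1 = prune (N.relax lv (fun w => (N.stage lv ok j w).1) v) := by
  classical
  rw [← h.1, stage_succ_fst]
  congr 1
  ext e
  rw [mem_relax, mem_relax]
  refine or_congr_right (exists_congr fun w => and_congr_right fun hw => ?_)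
  simp only [if_pos (h.2 w hw)]

theorem stage_fst_subset (j : ℕ) (v : Fin n) :
    (N.stage lv ok j v).1 ⊆ N.walkEntries lv j v := by
  classical
  induction j generalizing v with
  | zero => exact subset_rfl
  | succ j ih =>
    rw [stage_succ_fst]
    intro e he
    rw [walkEntries, mem_relax]
    refine (N.mem_relax.1 (prune_subset _ he)).imp_right fun ⟨w, hw, f, hf, h⟩ => ?_
    refine ⟨w, hw, f, ih w ?_, h⟩
    split_ifs at hf
    · exact hf
    · simp at hf

theorem prune_stage_fst (j : ℕ) (v : Fin n) :
    prune (N.stage lv ok j v).1 = (N.stage lv ok j v).1 := by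
  cases j with
  | zero =>
    ext e
    simp only [stage, mem_prune, Finset.mem_singleton]
    exact ⟨fun h => h.1, fun h => ⟨h, fun f hf _ => hf.trans h.symm⟩⟩
  | succ j => rw [stage_succ_fst, prune_prune]

theorem stage_fst_nonempty (j : ℕ) (v : Fin n) : (N.stage lv ok j v).1.Nonempty := by
  cases j with
  | zero => exact ⟨_, Finset.mem_singleton_self _⟩
  | succ j =>
    obtain ⟨e, he, -⟩ := prune_covers _ _ (N.mem_relax.2 (Or.inl rfl))
    exact ⟨e, he⟩

/-- Whatever the tables after `t` stages: if nothing gets lost in the next `r` stages, then all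
walks with at most `r` edges are taken into account. -/
theorem stage_covers_walkEntries {t r : ℕ}
    (h : ∀ i, t ≤ i → i < t + r → ∀ v, ok i (N.stage lv ok i v)) (v : Fin n) :
    Covers (N.stage lv ok (t + r) v).1 (N.walkEntries lv r v) := by
  classical
  induction r generalizing v with
  | zero =>
    rw [add_zero, walkEntries]
    intro e he
    rw [Finset.mem_singleton.1 he]
    cases t with
    | zero => exact ⟨_, Finset.mem_singleton_self _, le_rfl⟩
    | succ t => exact prune_covers _ _ (N.mem_relax.2 (Or.inl rfl))
  | succ r ih =>
    rw [← add_assoc, stage_succ_fst]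
    refine (prune_covers _).trans (N.relax_covers (fun w => ?_) v)
    rw [if_pos (h _ (by omega) (by omega) w)]
    exact ih (fun i hi hi' => h i hi (by omega)) w

theorem stage_fst_eq_prune_walkEntries {r : ℕ} (h : ∀ i < r, ∀ v, ok i (N.stage lv ok i v))
    (v : Fin n) : (N.stage lv ok r v).1 = prune (N.walkEntries lv r v) := by
  rw [← prune_stage_fst]
  refine prune_eq_of_covers ?_ (covers_of_subset (stage_fst_subset r v))
  simpa using stage_covers_walkEntries (t := 0) (r := r) (fun i _ hi => h i (by omega)) v

theorem prune_walkEntries {r : ℕ} (h : N.shortestPathDiameter ≤ r) (v : Fin n) :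
    prune (N.walkEntries lv r v) = prune (N.distEntries lv v) :=
  prune_eq_of_covers (N.walkEntries_covers_distEntries h v)
    (N.distEntries_covers_walkEntries r v)

/-- A table that takes all short walks into account is the front of the exact distances. -/
theorem stage_fst_eq_prune_distEntries {j : ℕ} {v : Fin n}
    (h : Covers (N.stage lv ok j v).1 (N.walkEntries lv N.shortestPathDiameter v)) :
    (N.stage lv ok j v).1 = prune (N.distEntries lv v) := by
  rw [← prune_stage_fst]
  exact prune_eq_of_covers (h.trans (N.walkEntries_covers_distEntries le_rfl v))
    ((N.distEntries_covers_walkEntries j v).trans (covers_of_subset (stage_fst_subset j v)))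

/-- If a whole ball of radius `2 * l + 1` around `u` is quiet in stage `l`, then this ball is the
whole network: an entry of the highest level that occurs in the ball cannot be pruned, hence
has spread over all of the ball, and in `l` stages it travels at most `l` edges. -/
theorem exists_walk_of_quiet {l : ℕ} {u : Fin n}
    (h : ∀ x (p : N.graph.Walk u x), p.length ≤ 2 * l + 1 → N.Quiet lv ok l x) (v : Fin n) :
    ∃ p : N.graph.Walk u v, p.length ≤ 2 * l := by
  classical
  let ball : Finset (Fin n) :=
    Finset.univ.filter fun x => ∃ p : N.graph.Walk u x, p.length ≤ 2 * l + 1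
  have mem_ball : ∀ {x}, x ∈ ball ↔ ∃ p : N.graph.Walk u x, p.length ≤ 2 * l + 1 := by
    simp [ball]
  have hu : u ∈ ball := mem_ball.2 ⟨.nil, Nat.zero_le _⟩
  obtain ⟨e, he, hmax⟩ := (ball.biUnion fun x => (N.stage lv ok l x).1).exists_max_image
    TZEntry.level (by
      obtain ⟨e, he⟩ := stage_fst_nonempty (N := N) (lv := lv) (ok := ok) l u
      exact ⟨e, Finset.mem_biUnion.2 ⟨u, hu, he⟩⟩)
  obtain ⟨x₀, hx₀, he⟩ := Finset.mem_biUnion.1 he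
  let P : Fin n → Prop := fun x => ∃ f ∈ (N.stage lv ok l x).1, f.level = e.level ∧ f.id = e.id
  have step : ∀ x y, y ∈ ball → N.graph.Adj y x → P x → P y := by
    rintro x y hy hxy ⟨f, hf, hfl, hfi⟩
    obtain ⟨p, hp⟩ := mem_ball.1 hy
    obtain ⟨g, hg, hgf⟩ := prune_covers _ _ (N.mem_relax (lv := lv)
      (X := fun w => (N.stage lv ok l w).1) |>.2 (Or.inr ⟨x, hxy, f, hf, rfl⟩))
    rw [← relax_congr_of_quiet (h y p hp)] at hg
    have hgl := hmax g (Finset.mem_biUnion.2 ⟨y, hy, hg⟩)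
    rcases hgf.2 with h' | h'
    · simp only [TZEntry.shift] at h'
      omega
    · exact ⟨g, hg, h'.1.trans hfl, h'.2.trans hfi⟩
  have spread : ∀ {x y : Fin n} (p : N.graph.Walk x y) (q : N.graph.Walk u x),
      q.length + p.length ≤ 2 * l + 1 → (P x ↔ P y) := by
    intro x y p
    induction p with
    | nil => exact fun _ _ => Iff.rfl
    | @cons x y z hxy p ih =>
      intro q hq
      rw [SimpleGraph.Walk.length_cons] at hq
      have hx : x ∈ ball := mem_ball.2 ⟨q, by omega⟩
      have hy : y ∈ ball := mem_ball.2 ⟨q.concat hxy, by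
        rw [SimpleGraph.Walk.length_concat]; omega⟩
      rw [← ih (q.concat hxy) (by rw [SimpleGraph.Walk.length_concat]; omega)]
      exact ⟨step x y hy hxy.symm, step y x hx hxy⟩
  have hP : ∀ x ∈ ball, P x := by
    have hPu : P u := by
      obtain ⟨p, hp⟩ := mem_ball.1 hx₀
      exact (spread p .nil (by simpa using hp)).2 ⟨e, he, rfl, rfl⟩
    intro x hx
    obtain ⟨p, hp⟩ := mem_ball.1 hx
    exact (spread p .nil (by simpa using hp)).1 hPu
  obtain ⟨w₀, p₀, -, hw₀⟩ := N.mem_walkEntries.1 (stage_fst_subset _ _ he)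
  have near : ∀ x ∈ ball, ∃ p : N.graph.Walk x w₀, p.length ≤ l := by
    intro x hx
    obtain ⟨f, hf, -, hfi⟩ := hP x hx
    obtain ⟨w, p, hp, rfl⟩ := N.mem_walkEntries.1 (stage_fst_subset _ _ hf)
    rw [hw₀] at hfi
    obtain rfl := N.id_injective hfi
    exact ⟨p, hp⟩
  have shrink : ∀ x ∈ ball, ∃ p : N.graph.Walk u x, p.length ≤ 2 * l := by
    intro x hx
    obtain ⟨p, hp⟩ := near u hu
    obtain ⟨q, hq⟩ := near x hx
    refine ⟨p.append q.reverse, ?_⟩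
    rw [SimpleGraph.Walk.length_append, SimpleGraph.Walk.length_reverse]
    omega
  have reach : ∀ {x y : Fin n} (_ : N.graph.Walk x y),
      (∃ p : N.graph.Walk u x, p.length ≤ 2 * l) → ∃ p : N.graph.Walk u y, p.length ≤ 2 * l := by
    intro x y p
    induction p with
    | nil => exact fun h => h
    | cons hxy p ih =>
      rintro ⟨q, hq⟩
      refine ih (shrink _ (mem_ball.2 ⟨q.concat hxy, ?_⟩))
      rw [SimpleGraph.Walk.length_concat]
      omega
  obtain ⟨p⟩ := N.connected.preconnected u v
  exact reach p ⟨.nil, Nat.zero_le _⟩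

/-- If all tables are reproduced by an undisturbed stage, they are the fronts of the
exact distances. -/
theorem stage_fst_eq_of_forall_quiet {l : ℕ} (h : ∀ v, N.Quiet lv ok l v) (v : Fin n) :
    (N.stage lv ok l v).1 = prune (N.distEntries lv v) := by
  have H : ∀ r v, Covers (N.stage lv ok l v).1 (N.walkEntries lv r v) := by
    intro r
    induction r with
    | zero =>
      intro v e he
      rw [relax_congr_of_quiet (h v)]
      exact prune_covers _ _ (N.mem_relax.2 (Or.inl (Finset.mem_singleton.1 he)))
    | succ r ih =>
      intro v
      rw [relax_congr_of_quiet (h v)]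
      exact (prune_covers _).trans (N.relax_covers ih v)
  exact stage_fst_eq_prune_distEntries (H _ v)

/-- If one node may halt, then all nodes may halt, and all tables are correct. The hypothesis on
`ok` says that a table that could be sent once can be sent again. -/
theorem stopped_and_correct (hn : 2 ≤ n) {Q : ℕ}
    (hok : ∀ i j T l l', i ≤ j → l' ≤ j → j < Q → ok i (T, l) → ok j (T, l'))
    {j : ℕ} (hj : j ≤ Q) {u : Fin n} (hu : N.Stopped lv ok j u) (v : Fin n) :
    N.Stopped lv ok j v ∧ (N.stage lv ok j v).1 = prune (N.distEntries lv v) := by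
  obtain ⟨l, hl⟩ : ∃ l, (N.stage lv ok j u).2 = l := ⟨_, rfl⟩
  rw [Stopped, hl] at hu
  have quiet : ∀ x (p : N.graph.Walk u x), p.length ≤ 2 * l + 1 → N.Quiet lv ok l x := by
    intro x p hp
    apply quiet_of_stage_snd_le
    have h₁ := stage_snd_le_of_walk (lv := lv) (ok := ok) p (l + 1)
    have h₂ := stage_snd_mono (N := N) (lv := lv) (ok := ok) (show l + 1 + p.length ≤ j by omega) u
    omega
  have quiet' : ∀ x, N.Quiet lv ok l x := fun x => by
    obtain ⟨p, hp⟩ := exists_walk_of_quiet quiet x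
    exact quiet x p (by omega)
  have hokl : ∀ x, ok l (N.stage lv ok l x) := fun x => by
    obtain ⟨y, hy⟩ := N.exists_adj hn x
    exact (quiet' y).2 x hy.symm
  have persist : ∀ t, l ≤ t → t ≤ j → ∀ x,
      (N.stage lv ok t x).1 = (N.stage lv ok l x).1 ∧ (N.stage lv ok t x).2 ≤ l := by
    intro t ht
    induction t, ht using Nat.le_induction with
    | base => exact fun _ x => ⟨rfl, stage_snd_le l x⟩
    | succ t ht ih =>
      intro htj
      have ih := ih (by omega)
      have hokt : ∀ x, ok t (N.stage lv ok t x) := fun x => by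
        have := hok l t (N.stage lv ok l x).1 _ (N.stage lv ok t x).2 ht
          (stage_snd_le t x) (by omega) (hokl x)
        rwa [← (ih x).1] at this
      have hT : ∀ x, (N.stage lv ok (t + 1) x).1 = (N.stage lv ok l x).1 := fun x => by
        classical
        rw [stage_succ_fst, relax_congr_of_quiet (quiet' x)]
        congr 2
        funext w
        rw [if_pos (hokt w), (ih w).1]
      refine fun x => ⟨hT x, ?_⟩
      classical
      rw [stage_succ_snd, if_pos ⟨(hT x).trans (ih x).1.symm, fun w _ => hokt w⟩]
      exact max_le (ih x).2 (Finset.sup_le fun w _ => (ih w).2)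
  obtain ⟨hT, hL⟩ := persist j (by omega) le_rfl v
  exact ⟨by rw [Stopped]; omega, hT.trans (stage_fst_eq_of_forall_quiet quiet' v)⟩

/-- If nothing happens any more after `s` stages, all nodes may halt after `3 * s + 2` stages. -/
theorem stopped_of_forall_quiet {s : ℕ}
    (h : ∀ t, s ≤ t → t < 3 * s + 2 → ∀ v, N.Quiet lv ok t v) (v : Fin n) :
    N.Stopped lv ok (3 * s + 2) v := by
  have H : ∀ t, s ≤ t → t ≤ 3 * s + 2 → ∀ x, (N.stage lv ok t x).2 ≤ s := by
    intro t ht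
    induction t, ht using Nat.le_induction with
    | base => exact fun _ x => stage_snd_le s x
    | succ t ht ih =>
      intro hts x
      classical
      rw [stage_succ_snd, if_pos (h t ht (by omega) x)]
      exact max_le (ih (by omega) x) (Finset.sup_le fun w _ => ih (by omega) w)
  have := H (3 * s + 2) (by omega) le_rfl v
  rw [Stopped]
  omega

end CongestNetwork

/-! ### Synchronous phases -/

/-- An algorithm that proceeds in phases. In phase `j` each node tells all its neighbours the same
message, of arbitrary size; a message that is too large for the phase gets lost. -/
structure PhasedAlgorithm (Msg Out : Type) where
  State : Type
  init : (ownId : ℕ) → (view : ℕ → Option ℕ) → (coins : ℕ → unitInterval) → State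
  msg : State → Msg
  step : State → (inbox : ℕ → Option Msg) → State
  output : State → Option Out

/-- A code that transmits in phase `j` those messages that satisfy `ok j`, in pieces of `B` bits,
one in each of the `len j` rounds of the phase. -/
structure PhaseCode (B : ℕ) (Msg : Type) (len : ℕ → ℕ) (ok : ℕ → Msg → Prop) where
  enc : ℕ → Msg → ℕ → Option (BitVec B)
  dec : ℕ → (ℕ → Option (BitVec B)) → Option Msg
  dec_enc : ∀ j m, ok j m → dec j (enc j m) = some m
  enc_of_not_ok : ∀ j m, ¬ ok j m → enc j m = fun _ => none
  enc_of_len_le : ∀ j m s, len j ≤ s → enc j m s = none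
  dec_none : ∀ j, dec j (fun _ => none) = none

/-- For the existence of a code it suffices that there are not too many messages. -/
theorem PhaseCode.nonempty_of_card_le {B : ℕ} {Msg : Type} {len : ℕ → ℕ} {G : ℕ → Finset Msg}
    (hlen : ∀ j, 0 < len j) (hG : ∀ j, (G j).card ≤ (2 ^ B) ^ len j) :
    Nonempty (PhaseCode B Msg len fun j m => m ∈ G j) := by
  classical
  have hcard : Fintype.card (BitVec B) = 2 ^ B := by
    rw [Fintype.card_congr BitVec.equivFin.toEquiv, Fintype.card_fin]
  have hemb : ∀ j, Nonempty (G j ↪ (Fin (len j) → BitVec B)) := fun j => by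
    refine Function.Embedding.nonempty_of_card_le ?_
    rw [Fintype.card_coe, Fintype.card_fun, Fintype.card_fin, hcard]
    exact hG j
  let enc : ℕ → Msg → ℕ → Option (BitVec B) := fun j m s =>
    if h : m ∈ G j ∧ s < len j then some ((hemb j).some ⟨m, h.1⟩ ⟨s, h.2⟩) else none
  have inj : ∀ j m m', m ∈ G j → m' ∈ G j → enc j m = enc j m' → m = m' := by
    intro j m m' hm hm' h
    have : (hemb j).some ⟨m, hm⟩ = (hemb j).some ⟨m', hm'⟩ := by
      funext s
      have := congrFun h s
      simpa [enc, hm, hm'] using this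
    exact congrArg Subtype.val ((hemb j).some.injective this)
  refine ⟨enc, fun j g => if h : ∃ m ∈ G j, enc j m = g then some h.choose else none,
    fun j m hm => ?_, fun j m hm => ?_, fun j m s hs => ?_, fun j => ?_⟩
  · have h : ∃ m' ∈ G j, enc j m' = enc j m := ⟨m, hm, rfl⟩
    rw [dif_pos h, inj j _ _ h.choose_spec.1 hm h.choose_spec.2]
  · funext s
    exact dif_neg fun h => hm h.1
  · exact dif_neg fun h => absurd h.2 (not_lt.2 hs)
  · refine dif_neg ?_
    rintro ⟨m, hm, h⟩
    have := congrFun h 0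
    simp [enc, hm, hlen j] at this

namespace PhasedAlgorithm

variable {Msg Out : Type} (P : PhasedAlgorithm Msg Out) {n a B : ℕ} (N : CongestNetwork n a)
  {len : ℕ → ℕ} {ok : ℕ → Msg → Prop}

open Classical in
/-- The configuration after `j` phases. -/
def phaseConfig (ok : ℕ → Msg → Prop) (ω : Fin n × ℕ → unitInterval) : ℕ → Fin n → P.State
  | 0 => fun v => P.init (N.id v) (N.localView v) (fun j => ω (v, j))
  | j + 1 => fun v => P.step (phaseConfig ok ω j v) (Function.extend N.id
      (fun w => if N.graph.Adj w v ∧ ok j (P.msg (phaseConfig ok ω j w)) then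
        some (P.msg (phaseConfig ok ω j w)) else none) fun _ => none)

/-- The round-by-round implementation of an algorithm that proceeds in phases. A state consists of
the state at the beginning of the phase, the phase, the number of rounds of this
phase that are over, and the pieces that have been received in this phase. -/
def toCongest (code : PhaseCode B Msg len ok) : CongestAlgorithm B Out where
  State := P.State × ℕ × ℕ × (ℕ → ℕ → Option (BitVec B))
  init ownId view coins := (P.init ownId view coins, 0, 0, fun _ _ => none)
  send σ _ := code.enc σ.2.1 (P.msg σ.1) σ.2.2.1
  receive σ inbox :=
    let buf : ℕ → ℕ → Option (BitVec B) := fun x s =>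
      if s = σ.2.2.1 then inbox x else σ.2.2.2 x s
    if σ.2.2.1 + 1 < len σ.2.1 then (σ.1, σ.2.1, σ.2.2.1 + 1, buf)
    else (P.step σ.1 fun x => code.dec σ.2.1 (buf x), σ.2.1 + 1, 0, fun _ _ => none)
  output σ := P.output σ.1

variable {P N}

open Classical in
theorem config_add {code : PhaseCode B Msg len ok} {ω : Fin n × ℕ → unitInterval}
    {σ : Fin n → P.State} {t j : ℕ}
    (ht : (P.toCongest code).config N ω t = fun v => (σ v, j, 0, fun _ _ => none))
    (hσ : ∀ v, P.output (σ v) = none) (s : ℕ) (hs : s < len j) :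
    (P.toCongest code).config N ω (t + s) = fun v => (σ v, j, s, fun x s' =>
      if s' < s then Function.extend N.id
        (fun w => if N.graph.Adj w v then code.enc j (P.msg (σ w)) s' else none) (fun _ => none) x
      else none) := by
  induction s with
  | zero => simpa using ht
  | succ s ih =>
    rw [← add_assoc, CongestAlgorithm.config, ih (by omega)]
    funext v
    simp only [CongestAlgorithm.round, CongestAlgorithm.inbox, CongestAlgorithm.sent, toCongest,
      hσ, if_true, hs, and_true, Prod.mk.injEq, true_and]
    funext x s'
    rcases lt_trichotomy s' s with h | rfl | h
    · simp [h, h.ne, Nat.lt_succ_of_lt h]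
    · simp
    · simp [h.ne', not_lt.2 h.le, show ¬ s' < s + 1 by omega]

theorem config_phase_succ {code : PhaseCode B Msg len ok} {ω : Fin n × ℕ → unitInterval}
    (hlen : ∀ j, 0 < len j) {t j : ℕ}
    (ht : (P.toCongest code).config N ω t =
      fun v => (P.phaseConfig N ok ω j v, j, 0, fun _ _ => none))
    (hσ : ∀ v, P.output (P.phaseConfig N ok ω j v) = none) :
    (P.toCongest code).config N ω (t + len j) =
      fun v => (P.phaseConfig N ok ω (j + 1) v, j + 1, 0, fun _ _ => none) := by
  classical
  obtain ⟨s, hs⟩ : ∃ s, len j = s + 1 := ⟨len j - 1, by have := hlen j; omega⟩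
  rw [hs, ← add_assoc, CongestAlgorithm.config, config_add ht hσ s (by omega)]
  funext v
  simp only [CongestAlgorithm.round, CongestAlgorithm.inbox, CongestAlgorithm.sent, toCongest,
    hσ, if_true, hs, lt_irrefl, if_false, and_true, Prod.mk.injEq, phaseConfig]
  congr 1
  funext x
  by_cases hx : ∃ w, N.id w = x
  · obtain ⟨w, rfl⟩ := hx
    simp only [N.id_injective.extend_apply]
    by_cases hw : N.graph.Adj w v
    · have : (fun s' => if s' = s then if N.graph.Adj w v then
          code.enc j (P.msg (P.phaseConfig N ok ω j w)) s else none
          else if s' < s then if N.graph.Adj w v then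
          code.enc j (P.msg (P.phaseConfig N ok ω j w)) s' else none else none) =
          code.enc j (P.msg (P.phaseConfig N ok ω j w)) := by
        funext s'
        rcases lt_trichotomy s' s with h | rfl | h
        · simp [h, h.ne, hw]
        · simp [hw]
        · simp [h.ne', not_lt.2 h.le, code.enc_of_len_le j _ s' (by omega)]
      rw [this]
      by_cases hok : ok j (P.msg (P.phaseConfig N ok ω j w))
      · rw [code.dec_enc _ _ hok, if_pos ⟨hw, hok⟩]
      · rw [code.enc_of_not_ok _ _ hok, code.dec_none, if_neg fun h => hok h.2]
    · simp [hw, code.dec_none]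
  · simp only [Function.extend_apply' _ _ _ hx, ite_self, code.dec_none]

theorem config_sum_len {code : PhaseCode B Msg len ok} {ω : Fin n × ℕ → unitInterval}
    (hlen : ∀ j, 0 < len j) (j : ℕ)
    (hσ : ∀ i < j, ∀ v, P.output (P.phaseConfig N ok ω i v) = none) :
    (P.toCongest code).config N ω (∑ i ∈ Finset.range j, len i) =
      fun v => (P.phaseConfig N ok ω j v, j, 0, fun _ _ => none) := by
  induction j with
  | zero => rfl
  | succ j ih =>
    rw [Finset.sum_range_succ]
    exact config_phase_succ hlen (ih fun i hi => hσ i (by omega)) (hσ j (by omega))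

theorem outputAt_sum_len {code : PhaseCode B Msg len ok} {ω : Fin n × ℕ → unitInterval}
    (hlen : ∀ j, 0 < len j) (j : ℕ)
    (hσ : ∀ i < j, ∀ v, P.output (P.phaseConfig N ok ω i v) = none) (v : Fin n) :
    (P.toCongest code).outputAt N ω (∑ i ∈ Finset.range j, len i) v =
      P.output (P.phaseConfig N ok ω j v) := by
  rw [CongestAlgorithm.outputAt, config_sum_len hlen j hσ]
  rfl

end PhasedAlgorithm

/-- In each round at most one message is sent over each edge in each direction. -/
theorem CongestAlgorithm.messagesUpTo_le {B n a : ℕ} {Out : Type} (alg : CongestAlgorithm B Out)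
    (N : CongestNetwork n a) (ω : Fin n × ℕ → unitInterval) (t : ℕ) :
    alg.messagesUpTo N ω t ≤ t * (2 * N.numEdges) := by
  classical
  have hcard : (Finset.univ.filter fun q : Fin n × Fin n => N.graph.Adj q.1 q.2).card =
      2 * N.numEdges := by
    rw [CongestNetwork.numEdges, ← SimpleGraph.coe_edgeFinset, Set.ncard_coe_finset,
      ← SimpleGraph.dart_card_eq_twice_card_edges, ← Finset.card_univ]
    refine (Finset.card_bij (fun d _ => d.toProd) ?_ ?_ ?_).symm
    · exact fun d _ => Finset.mem_filter.2 ⟨Finset.mem_univ _, d.adj⟩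
    · exact fun d _ d' _ h => SimpleGraph.Dart.ext _ _ h
    · exact fun q hq => ⟨⟨q, (Finset.mem_filter.1 hq).2⟩, Finset.mem_univ _, rfl⟩
  rw [messagesUpTo]
  refine (Finset.sum_le_card_nsmul _ _ (2 * N.numEdges) fun s _ => ?_).trans_eq
    (by rw [Finset.card_range, smul_eq_mul])
  rw [← hcard]
  refine Finset.card_le_card fun q hq => ?_
  rw [Finset.mem_filter] at hq ⊢
  refine ⟨hq.1, ?_⟩
  by_contra h
  simp [sent, h] at hq

/-! ### The distributed algorithm -/

/-- What a node remembers between two phases: besides what it knows from the beginning, the number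
of phases that are over, its table, and the number `lastNews` of the last phase from which it has
heard that something was still going on. -/
structure TZState where
  ownId : ℕ
  view : ℕ → Option ℕ
  level : ℕ
  time : ℕ
  table : Finset TZEntry
  lastNews : ℕ

open Classical in
/-- The code of a node for one stage of `CongestNetwork.stage`. All identifiers are less
than `I`. -/
def tzAlgorithm (n k I : ℕ) : PhasedAlgorithm (Finset TZEntry × ℕ) (DistSketch k) where
  State := TZState
  init ownId view coins :=
    ⟨ownId, view, tzLevel n k coins, 0, {⟨tzLevel n k coins, 0, ownId⟩}, 0⟩
  msg σ := (σ.table, σ.lastNews)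
  step σ inbox :=
    let T := prune (insert ⟨σ.level, 0, σ.ownId⟩ ((Finset.range I).biUnion fun x =>
      (inbox x).elim ∅ fun m => m.1.image (TZEntry.shift ((σ.view x).getD 0))))
    { σ with
      time := σ.time + 1
      table := T
      lastNews := if T = σ.table ∧ ∀ x, σ.view x ≠ none → inbox x ≠ none then
          max σ.lastNews ((Finset.range I).sup fun x => (inbox x).elim 0 Prod.snd)
        else σ.time + 1 }
  output σ := if 3 * σ.lastNews + 2 ≤ σ.time then some (sketchOf k σ.table) else none

namespace CongestNetwork

variable {n a k : ℕ} {N : CongestNetwork n a}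

theorem phaseConfig_tzAlgorithm (ok : ℕ → Finset TZEntry × ℕ → Prop)
    (ω : Fin n × ℕ → unitInterval) (j : ℕ) (v : Fin n) :
    (tzAlgorithm n k (n ^ a)).phaseConfig N ok ω j v =
      ⟨N.id v, N.localView v, tzLevel n k fun j => ω (v, j), j,
        (N.stage (fun v => tzLevel n k fun j => ω (v, j)) ok j v).1,
        (N.stage (fun v => tzLevel n k fun j => ω (v, j)) ok j v).2⟩ := by
  classical
  set lv : Fin n → ℕ := fun v => tzLevel n k fun j => ω (v, j) with hlv
  induction j generalizing v with
  | zero => rfl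
  | succ j ih =>
    have hview : ∀ w, N.localView v (N.id w) =
        if N.graph.Adj v w then some (N.weight s(v, w)) else none := fun w => by
      rw [localView, N.id_injective.extend_apply]
    have hview' : ∀ x, (¬ ∃ w, N.id w = x) → N.localView v x = none := fun x hx => by
      rw [localView, Function.extend_apply' _ _ _ hx]
    obtain ⟨inbox, hinbox⟩ : ∃ f : ℕ → Option (Finset TZEntry × ℕ), f = Function.extend N.id
      (fun w => if N.graph.Adj w v ∧ ok j (N.stage lv ok j w) then
        some (N.stage lv ok j w) else none) (fun _ => none) := ⟨_, rfl⟩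
    have hin : ∀ w, inbox (N.id w) = if N.graph.Adj w v ∧ ok j (N.stage lv ok j w) then
        some (N.stage lv ok j w) else none := fun w => by
      rw [hinbox, N.id_injective.extend_apply]
    have hin' : ∀ x, (¬ ∃ w, N.id w = x) → inbox x = none := fun x hx => by
      rw [hinbox, Function.extend_apply' _ _ _ hx]
    have hstep : (tzAlgorithm n k (n ^ a)).phaseConfig N ok ω (j + 1) v =
        (tzAlgorithm n k (n ^ a)).step ⟨N.id v, N.localView v, lv v, j,
          (N.stage lv ok j v).1, (N.stage lv ok j v).2⟩ inbox := by
      have hmsg : ∀ w, (tzAlgorithm n k (n ^ a)).msg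
          ((tzAlgorithm n k (n ^ a)).phaseConfig N ok ω j w) = N.stage lv ok j w :=
        fun w => congrArg (tzAlgorithm n k (n ^ a)).msg (ih w)
      refine congrArg₂ (tzAlgorithm n k (n ^ a)).step (ih v) ?_
      simp only [hinbox, hmsg]
    have hT : (insert ⟨lv v, 0, N.id v⟩ ((Finset.range (n ^ a)).biUnion fun x =>
        (inbox x).elim ∅ fun m => m.1.image (TZEntry.shift ((N.localView v x).getD 0)))) =
        N.relax lv (fun w => if ok j (N.stage lv ok j w) then (N.stage lv ok j w).1 else ∅) v := by
      ext e
      rw [mem_relax, Finset.mem_insert, Finset.mem_biUnion]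
      refine or_congr Iff.rfl ⟨?_, ?_⟩
      · rintro ⟨x, -, he⟩
        by_cases hx : ∃ w, N.id w = x
        · obtain ⟨w, rfl⟩ := hx
          rw [hin, hview] at he
          split_ifs at he with h h' h'
          · obtain ⟨f, hf, rfl⟩ := Finset.mem_image.1 he
            exact ⟨w, h', f, by rwa [if_pos h.2], rfl⟩
          · exact absurd h.1.symm h'
          · simp at he
          · simp at he
        · rw [hin' x hx] at he
          simp at he
      · rintro ⟨w, hw, f, hf, rfl⟩
        split_ifs at hf with h
        · refine ⟨N.id w, Finset.mem_range.2 (N.id_lt w), ?_⟩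
          rw [hin, hview, if_pos hw, if_pos ⟨hw.symm, h⟩]
          exact Finset.mem_image_of_mem _ hf
        · simp at hf
    have hq : (∀ x, N.localView v x ≠ none → inbox x ≠ none) ↔
        ∀ w, N.graph.Adj v w → ok j (N.stage lv ok j w) := by
      constructor
      · intro h w hw
        have := h (N.id w) (by simp [hview, hw])
        by_contra hcon
        simp [hin, hcon] at this
      · intro h x hx
        by_cases hx' : ∃ w, N.id w = x
        · obtain ⟨w, rfl⟩ := hx'
          have hw : N.graph.Adj v w := by
            by_contra hcon
            simp [hview, hcon] at hx
          simp [hin, hw.symm, h w hw]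
        · exact absurd (hview' x hx') hx
    rw [hstep, stage_succ_fst, stage_succ_snd]
    simp only [tzAlgorithm, hT, hq, TZState.mk.injEq, true_and]
    by_cases hQ : N.Quiet lv ok j v
    · rw [if_pos hQ]
      refine ⟨rfl, (if_pos hQ).trans (congrArg _ ?_)⟩
      apply le_antisymm
      · refine Finset.sup_le fun x _ => ?_
        by_cases hx : ∃ w, N.id w = x
        · obtain ⟨w, rfl⟩ := hx
          rw [hin]
          split_ifs with h
          · exact Finset.le_sup (f := fun w => (N.stage lv ok j w).2)
              (Finset.mem_filter.2 ⟨Finset.mem_univ w, h.1.symm⟩)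
          · exact Nat.zero_le _
        · rw [hin' x hx]
          exact Nat.zero_le _
      · refine Finset.sup_le fun w hw => ?_
        have hw := (Finset.mem_filter.1 hw).2
        refine le_trans ?_ (Finset.le_sup (Finset.mem_range.2 (N.id_lt w)))
        rw [hin, if_pos ⟨hw.symm, hQ.2 w hw⟩]
        exact le_rfl
    · rw [if_neg hQ]
      exact ⟨rfl, if_neg hQ⟩

theorem output_tzAlgorithm (ok : ℕ → Finset TZEntry × ℕ → Prop)
    (ω : Fin n × ℕ → unitInterval) (j : ℕ) (v : Fin n) :
    (tzAlgorithm n k (n ^ a)).output ((tzAlgorithm n k (n ^ a)).phaseConfig N ok ω j v) =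
      open Classical in
      if N.Stopped (fun v => tzLevel n k fun j => ω (v, j)) ok j v then
        some (sketchOf k (N.stage (fun v => tzLevel n k fun j => ω (v, j)) ok j v).1)
      else none := by
  rw [phaseConfig_tzAlgorithm]
  split_ifs with h
  · exact if_pos h
  · exact if_neg h

end CongestNetwork

/-! ### Messages and their number -/

/-- The number of subsets with at most `m` elements of a set with `k * P` elements. Weighting a
subset `t` by `P ^ (- #t)`, all subsets together weigh at most `exp k`. -/
theorem card_powerset_filter_card_le {α : Type*} (s : Finset α) {k P m : ℕ} (hP : 0 < P)
    (hs : s.card ≤ k * P) :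
    (s.powerset.filter fun t => t.card ≤ m).card ≤ 3 ^ k * P ^ m := by
  have hP' : (1 : ℝ) ≤ P := by exact_mod_cast hP
  have h₁ : ((s.powerset.filter fun t => t.card ≤ m).card : ℝ) * (P : ℝ)⁻¹ ^ m ≤ 3 ^ k := by
    calc ((s.powerset.filter fun t => t.card ≤ m).card : ℝ) * (P : ℝ)⁻¹ ^ m
        = ∑ t ∈ s.powerset.filter fun t => t.card ≤ m, (P : ℝ)⁻¹ ^ m := by
          rw [Finset.sum_const, nsmul_eq_mul]
      _ ≤ ∑ t ∈ s.powerset.filter fun t => t.card ≤ m, (P : ℝ)⁻¹ ^ t.card :=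
          Finset.sum_le_sum fun t ht => pow_le_pow_of_le_one (by positivity)
            (inv_le_one_of_one_le₀ hP') (Finset.mem_filter.1 ht).2
      _ ≤ ∑ t ∈ s.powerset, (P : ℝ)⁻¹ ^ t.card * 1 ^ (s.card - t.card) := by
          simp only [one_pow, mul_one]
          exact Finset.sum_le_sum_of_subset_of_nonneg (Finset.filter_subset _ _)
            fun _ _ _ => by positivity
      _ = ((P : ℝ)⁻¹ + 1) ^ s.card := Finset.sum_pow_mul_eq_add_pow _ _ _
      _ ≤ Real.exp (P : ℝ)⁻¹ ^ (k * P) := by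
          refine (pow_le_pow_right₀ (by simp) hs).trans ?_
          exact pow_le_pow_left₀ (by positivity) (Real.add_one_le_exp _) _
      _ = Real.exp 1 ^ k := by
          rw [mul_comm k, pow_mul, ← Real.exp_nat_mul, mul_inv_cancel₀ (by positivity)]
      _ ≤ 3 ^ k := pow_le_pow_left₀ (Real.exp_pos 1).le Real.exp_one_lt_three.le k
  rw [inv_pow, mul_inv_le_iff₀ (by positivity)] at h₁
  exact_mod_cast h₁

open Classical in
/-- The entries with level less than `k`, distance less than `D` and identifier less than `I`. -/
def entryBox (k D I : ℕ) : Finset TZEntry :=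
  (Finset.range k ×ˢ Finset.range D ×ˢ Finset.range I).image fun x => ⟨x.1, x.2.1, x.2.2⟩

theorem mem_entryBox {k D I : ℕ} {e : TZEntry} :
    e ∈ entryBox k D I ↔ e.level < k ∧ e.dist < D ∧ e.id < I := by
  classical
  simp only [entryBox, Finset.mem_image, Finset.mem_product, Finset.mem_range]
  exact ⟨by rintro ⟨x, hx, rfl⟩; exact hx, fun h => ⟨⟨_, _, _⟩, h, rfl⟩⟩

/-- The messages with a table of at most `m` entries and a stage number less than `Q`. -/
def messageBox (k D I Q m : ℕ) : Finset (Finset TZEntry × ℕ) :=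
  ((entryBox k D I).powerset.filter fun T => T.card ≤ m) ×ˢ Finset.range Q

theorem mem_messageBox {k D I Q m : ℕ} {x : Finset TZEntry × ℕ} :
    x ∈ messageBox k D I Q m ↔ (x.1 ⊆ entryBox k D I ∧ x.1.card ≤ m) ∧ x.2 < Q := by
  simp [messageBox]

theorem card_messageBox_le {k D I Q m B : ℕ} (hD : 0 < D) (hI : 0 < I) (hm : 0 < m)
    (hk : k ≤ m) (hB : 3 * (D * I) * Q ≤ 2 ^ B) :
    (messageBox k D I Q m).card ≤ (2 ^ B) ^ m := by
  classical
  rw [messageBox, Finset.card_product, Finset.card_range]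
  have h : (entryBox k D I).card ≤ k * (D * I) := by
    refine Finset.card_image_le.trans ?_
    simp
  calc _ ≤ 3 ^ k * (D * I) ^ m * Q :=
        Nat.mul_le_mul_right _ (card_powerset_filter_card_le _ (by positivity) h)
    _ ≤ 3 ^ m * (D * I) ^ m * Q ^ m := by
        refine Nat.mul_le_mul (Nat.mul_le_mul_right _ (Nat.pow_le_pow_right (by norm_num) hk)) ?_
        exact Nat.le_self_pow hm.ne' Q
    _ = (3 * (D * I) * Q) ^ m := by simp only [mul_pow]
    _ ≤ (2 ^ B) ^ m := Nat.pow_le_pow_left hB m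

/-! ### Running time -/

/-- A front has at most one entry per node. -/
theorem card_prune_le {n : ℕ} {X : Finset TZEntry} (lv id : Fin n → ℕ)
    (h : ∀ e ∈ X, ∃ w, e.level = lv w ∧ e.id = id w) (hid : Function.Injective id) :
    (prune X).card ≤ n := by
  classical
  refine (Finset.card_le_card_of_injOn (t := Finset.univ.image id) TZEntry.id ?_ ?_).trans
    (Finset.card_image_le.trans_eq (by simp))
  · intro e he
    obtain ⟨w, -, hw⟩ := h e (prune_subset _ he)
    simp [hw]
  · intro e he f hf hef
    obtain ⟨v, hvl, hvi⟩ := h e (prune_subset _ he)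
    obtain ⟨w, hwl, hwi⟩ := h f (prune_subset _ hf)
    obtain rfl : v = w := hid (by rw [← hvi, ← hwi, hef])
    rcases le_total e.key f.key with hle | hle
    · exact (mem_prune.1 hf).2 e (prune_subset _ he) ⟨hle, Or.inr ⟨hvl.trans hwl.symm, hef⟩⟩
    · exact ((mem_prune.1 he).2 f (prune_subset _ hf)
        ⟨hle, Or.inr ⟨hwl.trans hvl.symm, hef.symm⟩⟩).symm

/-- The number of rounds of phase `j`, which is also the size of the largest table that can
be sent in this phase. After `3 * n + 3` phases there is enough room for every table. -/
def phaseLength (n K j : ℕ) : ℕ := if j < 3 * n + 3 then K else K + n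

/-- The messages that can be sent in phase `j`. -/
def Sendable (n a k K j : ℕ) (x : Finset TZEntry × ℕ) : Prop :=
  x ∈ messageBox k ((12 * n + 12) * n ^ a) (n ^ a) (12 * n + 12) (phaseLength n K j)

theorem phaseLength_mono (n K : ℕ) : Monotone (phaseLength n K) := fun i j h => by
  unfold phaseLength
  split_ifs <;> omega

theorem le_phaseLength (n K j : ℕ) : K ≤ phaseLength n K j := by
  unfold phaseLength
  split_ifs <;> omega

theorem nonempty_phaseCode {n a k K : ℕ} (hn : 2 ≤ n) (hK : 0 < K) (hk : k ≤ K) :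
    Nonempty (PhaseCode ((2 * a + 14) * Nat.clog 2 n) (Finset TZEntry × ℕ) (phaseLength n K)
      (Sendable n a k K)) := by
  have hna : 0 < n ^ a := by positivity
  refine PhaseCode.nonempty_of_card_le
    (fun j => hK.trans_le (le_phaseLength n K j)) fun j => card_messageBox_le (by positivity) hna
      (hK.trans_le (le_phaseLength n K j)) (hk.trans (le_phaseLength n K j)) ?_
  have h₁ : 12 * n + 12 ≤ n ^ 6 := by
    have : 2 ^ 5 ≤ n ^ 5 := Nat.pow_le_pow_left hn 5
    calc 12 * n + 12 ≤ 2 ^ 5 * n := by omega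
      _ ≤ n ^ 5 * n := Nat.mul_le_mul_right _ this
      _ = n ^ 6 := by ring
  have h₂ : 3 ≤ n ^ 2 := by nlinarith
  calc 3 * ((12 * n + 12) * n ^ a * n ^ a) * (12 * n + 12)
      ≤ n ^ 2 * (n ^ 6 * n ^ a * n ^ a) * n ^ 6 := by gcongr
    _ = n ^ (2 * a + 14) := by ring
    _ ≤ (2 ^ Nat.clog 2 n) ^ (2 * a + 14) :=
        Nat.pow_le_pow_left (Nat.le_pow_clog (by norm_num) n) _
    _ = 2 ^ ((2 * a + 14) * Nat.clog 2 n) := by rw [← pow_mul, mul_comm]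

namespace CongestNetwork

variable {n a k K : ℕ} {N : CongestNetwork n a} {lv : Fin n → ℕ}

theorem card_stage_fst_le (ok : ℕ → Finset TZEntry × ℕ → Prop) (j : ℕ) (v : Fin n) :
    (N.stage lv ok j v).1.card ≤ n := by
  rw [← prune_stage_fst]
  refine card_prune_le lv N.id (fun e he => ?_) N.id_injective
  obtain ⟨w, p, -, rfl⟩ := N.mem_walkEntries.1 (stage_fst_subset j v he)
  exact ⟨w, rfl, rfl⟩

/-- Only its size can prevent a table from being sent. -/
theorem sendable_stage (hlv : ∀ v, lv v < k) {ok : ℕ → Finset TZEntry × ℕ → Prop} {j : ℕ}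
    (hj : j < 12 * n + 12) {v : Fin n} (h : (N.stage lv ok j v).1.card ≤ phaseLength n K j) :
    Sendable n a k K j (N.stage lv ok j v) := by
  refine mem_messageBox.2 ⟨⟨fun e he => ?_, h⟩, (stage_snd_le j v).trans_lt hj⟩
  obtain ⟨w, p, hp, rfl⟩ := N.mem_walkEntries.1 (stage_fst_subset j v he)
  refine mem_entryBox.2 ⟨hlv w, (N.walkWeight_le p).trans_lt ?_, N.id_lt w⟩
  have hna : 0 < n ^ a := (Nat.zero_le _).trans_lt (N.id_lt w)
  exact Nat.mul_lt_mul_of_pos_right (hp.trans_lt hj) hna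

theorem quiet_of_forall_eq {ok : ℕ → Finset TZEntry × ℕ → Prop} {s m : ℕ}
    (hok : ∀ t, s ≤ t → t < m → ∀ v, ok t (N.stage lv ok t v))
    (h : ∀ t, s ≤ t → t ≤ m → ∀ v, (N.stage lv ok t v).1 = prune (N.distEntries lv v))
    (t : ℕ) (hs : s ≤ t) (hm : t < m) (v : Fin n) : N.Quiet lv ok t v :=
  ⟨by rw [h t hs hm.le, h (t + 1) (by omega) hm], fun w _ => hok t hs hm w⟩

/-- Eventually all tables can be sent, and then all nodes may halt some time. -/
theorem stopped_of_large_phases (hlv : ∀ v, lv v < k) (v : Fin n) :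
    N.Stopped lv (Sendable n a k K) (3 * (3 * n + 3 + N.shortestPathDiameter) + 2) v := by
  have hS := N.shortestPathDiameter_le
  have hok : ∀ t, 3 * n + 3 ≤ t → t < 12 * n + 12 → ∀ v,
      Sendable n a k K t (N.stage lv (Sendable n a k K) t v) := fun t ht ht' v => by
    refine sendable_stage hlv ht' ((card_stage_fst_le _ t v).trans ?_)
    rw [phaseLength, if_neg (by omega)]
    omega
  refine stopped_of_forall_quiet (quiet_of_forall_eq (fun t ht ht' => hok t (by omega) (by omega))
    fun t ht ht' v => stage_fst_eq_prune_distEntries ?_) v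
  obtain ⟨r, rfl⟩ := Nat.exists_eq_add_of_le (show 3 * n + 3 ≤ t by omega)
  exact (stage_covers_walkEntries (fun i hi hi' => hok i hi (by omega)) v).trans
    (covers_of_subset (N.walkEntries_mono (by omega) v))

/-- If all tables can be sent right from the start, the time depends on the shortest-path diameter
only. -/
theorem stopped_of_small_fronts (hlv : ∀ v, lv v < k)
    (h : ∀ r ≤ n, ∀ v, (prune (N.walkEntries lv r v)).card ≤ K) (v : Fin n) :
    N.Stopped lv (Sendable n a k K) (3 * N.shortestPathDiameter + 2) v := by
  have hS := N.shortestPathDiameter_le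
  have hcard : ∀ r v, (prune (N.walkEntries lv r v)).card ≤ K := fun r v => by
    rcases le_total r n with hr | hr
    · exact h r hr v
    · rw [prune_walkEntries (hS.trans hr), ← prune_walkEntries hS]
      exact h n le_rfl v
  have hok : ∀ t < 12 * n + 12, ∀ v,
      Sendable n a k K t (N.stage lv (Sendable n a k K) t v) := fun t => by
    induction t using Nat.strong_induction_on with
    | _ t ih =>
      intro ht v
      refine sendable_stage hlv ht (le_trans ?_ (le_phaseLength n K t))
      rw [stage_fst_eq_prune_walkEntries (fun i hi => ih i hi (hi.trans ht)) v]
      exact hcard t v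
  refine stopped_of_forall_quiet (quiet_of_forall_eq (fun t ht ht' => hok t (by omega))
    fun t ht ht' v => ?_) v
  rw [stage_fst_eq_prune_walkEntries (fun i hi => hok i (by omega)) v, prune_walkEntries ht]

/-- All nodes halt with the correct output, at the same time and no later than the first stage in
which they certainly may. -/
theorem exists_outputAt_eq (hn : 2 ≤ n) (hk : 1 ≤ k) (hK : 0 < K)
    (code : PhaseCode ((2 * a + 14) * Nat.clog 2 n) (Finset TZEntry × ℕ) (phaseLength n K)
      (Sendable n a k K)) (ω : Fin n × ℕ → unitInterval) {j : ℕ} (hj : j ≤ 12 * n + 12)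
    (hhalt : ∀ v, N.Stopped (fun v => tzLevel n k fun j => ω (v, j)) (Sendable n a k K) j v) :
    ∃ i ≤ j, ∀ v, ((tzAlgorithm n k (n ^ a)).toCongest code).outputAt N ω
      (∑ t ∈ Finset.range i, phaseLength n K t) v = some (N.tzLabel k ω v) := by
  classical
  have hex : ∃ i, ∃ v, N.Stopped (fun v => tzLevel n k fun j => ω (v, j))
      (Sendable n a k K) i v := ⟨j, ⟨0, by omega⟩, hhalt _⟩
  have hle : Nat.find hex ≤ j := Nat.find_min' hex ⟨⟨0, by omega⟩, hhalt _⟩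
  refine ⟨Nat.find hex, hle, fun v => ?_⟩
  have hresend : ∀ i j T l l', i ≤ j → l' ≤ j → j < 12 * n + 12 →
      Sendable n a k K i (T, l) → Sendable n a k K j (T, l') := by
    intro i j T l l' hij hl' hj h
    obtain ⟨⟨h₁, h₂⟩, -⟩ := mem_messageBox.1 h
    exact mem_messageBox.2 ⟨⟨h₁, h₂.trans (phaseLength_mono n K hij)⟩, hl'.trans_lt hj⟩
  obtain ⟨u, hu⟩ := Nat.find_spec hex
  obtain ⟨hs, hc⟩ := stopped_and_correct hn hresend (hle.trans hj) hu v
  rw [PhasedAlgorithm.outputAt_sum_len (fun j => hK.trans_le (le_phaseLength n K j)),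
    output_tzAlgorithm, if_pos hs, hc, sketchOf_prune_distEntries N hk]
  intro i hi w
  rw [output_tzAlgorithm, if_neg fun h => Nat.find_min hex hi ⟨w, h⟩]

theorem exists_outputAt_eq_of_small_fronts (hn : 2 ≤ n) (hk : 1 ≤ k) {K : ℕ} (hK : 0 < K)
    (code : PhaseCode ((2 * a + 14) * Nat.clog 2 n) (Finset TZEntry × ℕ) (phaseLength n K)
      (Sendable n a k K)) (ω : Fin n × ℕ → unitInterval)
    (h : ∀ r ≤ n, ∀ v,
      (prune (N.walkEntries (fun v => tzLevel n k fun j => ω (v, j)) r v)).card ≤ K) :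
    ∃ T ≤ 5 * N.shortestPathDiameter * K, ∀ v,
      ((tzAlgorithm n k (n ^ a)).toCongest code).outputAt N ω T v = some (N.tzLabel k ω v) := by
  have hS := N.shortestPathDiameter_le
  have hS' := N.shortestPathDiameter_pos hn
  obtain ⟨i, hi, hout⟩ := exists_outputAt_eq hn hk hK code ω (by omega)
    (stopped_of_small_fronts (fun v => tzLevel_lt hk _) h)
  refine ⟨_, ?_, hout⟩
  calc ∑ t ∈ Finset.range i, phaseLength n K t = ∑ t ∈ Finset.range i, K :=
        Finset.sum_congr rfl fun t ht => if_pos (by have := Finset.mem_range.1 ht; omega)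
    _ = i * K := by rw [Finset.sum_const, Finset.card_range, smul_eq_mul]
    _ ≤ 5 * N.shortestPathDiameter * K := Nat.mul_le_mul_right _ (by omega)

end CongestNetwork

section

/-! ### Random samples -/

instance (n : ℕ) : IsProbabilityMeasure (coinLaw n) := by
  unfold coinLaw
  infer_instance

theorem coinLaw_forall_mem {n : ℕ} (F : Finset (Fin n × ℕ)) {t : Set unitInterval}
    (ht : MeasurableSet t) : coinLaw n {ω | ∀ x ∈ F, ω x ∈ t} = volume t ^ F.card := by
  have := Measure.infinitePi_pi (μ := fun _ : Fin n × ℕ => (volume : Measure unitInterval))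
    (s := F) (t := fun _ => t) fun _ _ => ht
  rw [Finset.prod_const] at this
  exact this

/-- The nodes whose first `i` random numbers are at most `P`. -/
def survivors {n : ℕ} (P : unitInterval) (i : ℕ) (ω : Fin n × ℕ → unitInterval) :
    Finset (Fin n) :=
  Finset.univ.filter fun v => ∀ j < i, ω (v, j) ≤ P

open Classical in
/-- The nodes of `R` in `A` that precede all nodes of `R` in `A'`, in the order given by `key`. -/
def leading {n : ℕ} {α : Type*} [LinearOrder α] (key : Fin n → α) (R A A' : Finset (Fin n)) :
    Finset (Fin n) :=
  R.filter fun w => w ∈ A ∧ ∀ w' ∈ R, w' ∈ A' → key w < key w'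

variable {n : ℕ} {P : unitInterval} {α : Type*} [LinearOrder α]

theorem mem_survivors {i : ℕ} {ω : Fin n × ℕ → unitInterval} {v : Fin n} :
    v ∈ survivors P i ω ↔ ∀ j < i, ω (v, j) ≤ P := by
  simp [survivors]

theorem measurableSet_mem_survivors (i : ℕ) (v : Fin n) :
    MeasurableSet {ω : Fin n × ℕ → unitInterval | v ∈ survivors P i ω} := by
  simp only [mem_survivors, Set.ofPred_forall]
  exact MeasurableSet.iInter fun j => MeasurableSet.iInter fun _ =>
    measurableSet_le (measurable_pi_apply _) measurable_const

theorem measurable_card_survivors (i : ℕ) :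
    Measurable fun ω : Fin n × ℕ → unitInterval => (survivors P i ω).card := by
  classical
  have : (fun ω : Fin n × ℕ → unitInterval => (survivors P i ω).card) = fun ω =>
      ∑ v : Fin n, if v ∈ survivors P i ω then 1 else 0 := by
    funext ω
    simp
  rw [this]
  exact Finset.measurable_sum _ fun v _ =>
    Measurable.ite (measurableSet_mem_survivors i v) measurable_const measurable_const

theorem mem_leading {key : Fin n → α} {R A A' : Finset (Fin n)} {w : Fin n} :
    w ∈ leading key R A A' ↔ w ∈ R ∧ w ∈ A ∧ ∀ w' ∈ R, w' ∈ A' → key w < key w' := by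
  simp [leading]

theorem measurable_card_leading (key : Fin n → α) (R : Finset (Fin n))
    {A A' : (Fin n × ℕ → unitInterval) → Finset (Fin n)}
    (hA : ∀ v, MeasurableSet {ω | v ∈ A ω}) (hA' : ∀ v, MeasurableSet {ω | v ∈ A' ω}) :
    Measurable fun ω => (leading key R (A ω) (A' ω)).card := by
  classical
  have hmem : ∀ w, MeasurableSet {ω | w ∈ leading key R (A ω) (A' ω)} := fun w => by
    simp only [mem_leading]
    refine (MeasurableSet.const _).inter ((hA w).inter ?_)
    change MeasurableSet {ω | ∀ w', w' ∈ R → w' ∈ A' ω → key w < key w'}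
    simp only [Set.ofPred_forall]
    refine MeasurableSet.iInter fun w' => MeasurableSet.iInter fun _ => ?_
    simp only [imp_iff_not_or, Set.ofPred_or]
    exact (hA' w').compl.union (MeasurableSet.const _)
  have : (fun ω => (leading key R (A ω) (A' ω)).card) = fun ω =>
      ∑ w : Fin n, if w ∈ leading key R (A ω) (A' ω) then 1 else 0 := by
    funext ω
    simp
  rw [this]
  exact Finset.measurable_sum _ fun w _ =>
    Measurable.ite (hmem w) measurable_const measurable_const

theorem exists_initial_segment (key : Fin n → α) (hkey : Function.Injective key)
    (B : Finset (Fin n)) {m : ℕ} (hm : m ≤ B.card) :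
    ∃ F ⊆ B, F.card = m ∧ ∀ x ∈ F, ∀ y ∈ B, y ∉ F → key x < key y := by
  classical
  induction m with
  | zero => exact ⟨∅, Finset.empty_subset _, rfl, by simp⟩
  | succ m ih =>
    obtain ⟨F, hFB, hF, hlt⟩ := ih (by omega)
    have hne : (B \ F).Nonempty := by
      rw [← Finset.card_pos, Finset.card_sdiff_of_subset hFB]
      omega
    obtain ⟨x, hx, hmin⟩ := (B \ F).exists_min_image key hne
    obtain ⟨hxB, hxF⟩ := Finset.mem_sdiff.1 hx
    refine ⟨insert x F, Finset.insert_subset hxB hFB, by rw [Finset.card_insert_of_notMem hxF, hF],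
      fun y hy z hz hzF => ?_⟩
    rw [Finset.mem_insert, not_or] at hzF
    rcases Finset.mem_insert.1 hy with rfl | hy
    · exact lt_of_le_of_ne (hmin z (Finset.mem_sdiff.2 ⟨hz, hzF.2⟩))
        fun h => hzF.1 (hkey h).symm
    · exact hlt y hy z hz hzF.2

/-- The `i`-th sample and the random numbers with index `i` are independent. -/
theorem coinLaw_survivors_eq_inter (i : ℕ) (A F : Finset (Fin n)) :
    coinLaw n ({ω | survivors P i ω = A} ∩ {ω | ∀ w ∈ F, P < ω (w, i)}) =
      coinLaw n {ω | survivors P i ω = A} * ENNReal.ofReal (1 - P) ^ F.card := by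
  classical
  have hind : ProbabilityTheory.iIndepFun (fun (x : Fin n × ℕ) ω => ω x) (coinLaw n) :=
    ProbabilityTheory.iIndepFun_infinitePi
      (P := fun _ : Fin n × ℕ => (volume : Measure unitInterval)) (X := fun _ ω => ω)
      fun _ => measurable_id
  let S : Finset (Fin n × ℕ) := Finset.univ ×ˢ Finset.range i
  let T : Finset (Fin n × ℕ) := Finset.univ ×ˢ {i}
  have hST : Disjoint S T := by
    rw [Finset.disjoint_left]
    rintro ⟨v, j⟩ h₁ h₂
    simp only [S, T, Finset.mem_product, Finset.mem_range, Finset.mem_singleton] at h₁ h₂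
    omega
  have hS : ∀ v j, j < i → (v, j) ∈ S := fun v j hj => by simp [S, hj]
  have hT : ∀ v, (v, i) ∈ T := fun v => by simp [T]
  have h := hind.indepFun_finset S T hST fun x => measurable_pi_apply x
  let E₁ : Set (S → unitInterval) := {g | ∀ v, v ∈ A ↔ ∀ j (hj : j < i), g ⟨(v, j), hS v j hj⟩ ≤ P}
  let E₂ : Set (T → unitInterval) := {g | ∀ w ∈ F, P < g ⟨(w, i), hT w⟩}
  have hE₁ : MeasurableSet E₁ := by
    simp only [E₁, Set.ofPred_forall]
    refine MeasurableSet.iInter fun v => ?_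
    have hm : MeasurableSet {g : S → unitInterval | ∀ j (hj : j < i), g ⟨(v, j), hS v j hj⟩ ≤ P} := by
      simp only [Set.ofPred_forall]
      exact MeasurableSet.iInter fun j => MeasurableSet.iInter fun _ =>
        measurableSet_le (measurable_pi_apply _) measurable_const
    by_cases hv : v ∈ A
    · simpa [hv] using hm
    · simp only [hv, false_iff]
      exact hm.compl
  have hE₂ : MeasurableSet E₂ := by
    simp only [E₂, Set.ofPred_forall]
    exact MeasurableSet.iInter fun w => MeasurableSet.iInter fun _ =>
      measurableSet_lt measurable_const (measurable_pi_apply _)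
  have h₁ : {ω | survivors P i ω = A} = (fun ω (x : S) => ω x) ⁻¹' E₁ := by
    ext ω
    simp only [Set.mem_ofPred_eq, Set.mem_preimage, E₁, Finset.ext_iff, mem_survivors]
    exact forall_congr' fun v => Iff.comm
  have h₂ : {ω : Fin n × ℕ → unitInterval | ∀ w ∈ F, P < ω (w, i)} =
      (fun ω (x : T) => ω x) ⁻¹' E₂ := rfl
  have h₃ : coinLaw n {ω | ∀ w ∈ F, P < ω (w, i)} = ENNReal.ofReal (1 - P) ^ F.card := by
    have := coinLaw_forall_mem (n := n) (F.map ⟨fun w => (w, i), fun _ _ h => congrArg Prod.fst h⟩)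
      (t := Set.Ioi P) measurableSet_Ioi
    rw [Finset.card_map, unitInterval.volume_Ioi] at this
    rw [← this]
    congr 1
    ext ω
    exact ⟨fun h x hx => by obtain ⟨w, hw, rfl⟩ := Finset.mem_map.1 hx; exact h w hw,
      fun h w hw => h _ (Finset.mem_map_of_mem _ hw)⟩
  rw [← h₃, h₁, h₂]
  exact h.measure_inter_preimage_eq_mul _ _ hE₁ hE₂

/-- The number of members of the `i`-th sample that precede all members of the next sample has
a geometric tail: whatever the `i`-th sample is, its first `m` members have to fail. -/
theorem coinLaw_le_card_leading (key : Fin n → α) (hkey : Function.Injective key)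
    (R : Finset (Fin n)) (i m : ℕ) :
    coinLaw n {ω | m ≤ (leading key R (survivors P i ω) (survivors P (i + 1) ω)).card} ≤
      ENNReal.ofReal (1 - P) ^ m := by
  classical
  have hF : ∀ A : Finset (Fin n), ∃ F : Finset (Fin n), m ≤ (R ∩ A).card →
      F ⊆ R ∩ A ∧ F.card = m ∧ ∀ x ∈ F, ∀ y ∈ R ∩ A, y ∉ F → key x < key y := fun A => by
    by_cases h : m ≤ (R ∩ A).card
    · obtain ⟨F, hF⟩ := exists_initial_segment key hkey (R ∩ A) h
      exact ⟨F, fun _ => hF⟩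
    · exact ⟨∅, fun h' => absurd h' h⟩
  choose F hF using hF
  have hsub : {ω | m ≤ (leading key R (survivors P i ω) (survivors P (i + 1) ω)).card} ⊆
      ⋃ A ∈ (Finset.univ.filter fun A : Finset (Fin n) => m ≤ (R ∩ A).card),
        ({ω | survivors P i ω = A} ∩ {ω | ∀ w ∈ F A, P < ω (w, i)}) := by
    intro ω hω
    set A := survivors P i ω with hA
    set Z := leading key R A (survivors P (i + 1) ω) with hZ
    have hm : m ≤ Z.card := hω
    have hZA : Z ⊆ R ∩ A := fun w hw => by
      have := mem_leading.1 hw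
      exact Finset.mem_inter.2 ⟨this.1, this.2.1⟩
    have hmA : m ≤ (R ∩ A).card := hm.trans (Finset.card_le_card hZA)
    obtain ⟨hFA, hFm, hlt⟩ := hF A hmA
    refine Set.mem_iUnion₂.2 ⟨A, Finset.mem_filter.2 ⟨Finset.mem_univ _, hmA⟩, rfl, ?_⟩
    intro w hw
    -- `Z` is an initial segment of the sample with at least `m` members, so it contains `F A`.
    have hwZ : w ∈ Z := by
      by_contra hwZ
      have hZF : Z ⊆ (F A).erase w := fun y hy => by
        have hyw : y ≠ w := fun h => hwZ (h ▸ hy)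
        refine Finset.mem_erase.2 ⟨hyw, ?_⟩
        by_contra hyF
        have hwy := hlt w hw y (hZA hy) hyF
        have hwRA := Finset.mem_inter.1 (hFA hw)
        exact hwZ (mem_leading.2 ⟨hwRA.1, hwRA.2, fun z hz hz' =>
          hwy.trans ((mem_leading.1 hy).2.2 z hz hz')⟩)
      have := Finset.card_le_card hZF
      rw [Finset.card_erase_of_mem hw] at this
      have := Finset.card_pos.2 ⟨w, hw⟩
      omega
    obtain ⟨hwR, hwA, hwlt⟩ := mem_leading.1 hwZ
    by_contra hcon
    refine lt_irrefl _ (hwlt w hwR (mem_survivors.2 fun j hj => ?_))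
    rcases Nat.lt_succ_iff_lt_or_eq.1 hj with hj | rfl
    · exact mem_survivors.1 hwA j hj
    · exact not_lt.1 hcon
  have hmeas : ∀ A : Finset (Fin n),
      MeasurableSet {ω : Fin n × ℕ → unitInterval | survivors P i ω = A} := fun A => by
    simp only [Finset.ext_iff, Set.ofPred_forall]
    refine MeasurableSet.iInter fun v => ?_
    by_cases hv : v ∈ A
    · simpa [hv] using measurableSet_mem_survivors i v
    · have h : {ω : Fin n × ℕ → unitInterval | v ∈ survivors P i ω ↔ v ∈ A} =
          {ω | v ∈ survivors P i ω}ᶜ := by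
        ext ω
        simp [hv]
      rw [h]
      exact (measurableSet_mem_survivors i v).compl
  refine (measure_mono hsub).trans ((measure_biUnion_finset_le _ _).trans ?_)
  calc _ = ∑ A ∈ (Finset.univ.filter fun A : Finset (Fin n) => m ≤ (R ∩ A).card),
        coinLaw n {ω | survivors P i ω = A} * ENNReal.ofReal (1 - P) ^ m :=
        Finset.sum_congr rfl fun A hA => by
          rw [coinLaw_survivors_eq_inter, (hF A (Finset.mem_filter.1 hA).2).2.1]
    _ ≤ ∑ A, coinLaw n {ω | survivors P i ω = A} * ENNReal.ofReal (1 - P) ^ m :=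
        Finset.sum_le_sum_of_subset (Finset.filter_subset _ _)
    _ = coinLaw n (⋃ A ∈ (Finset.univ : Finset (Finset (Fin n))), {ω | survivors P i ω = A}) *
          ENNReal.ofReal (1 - P) ^ m := by
        rw [← Finset.sum_mul, measure_biUnion_finset _ fun A _ => hmeas A]
        intro A _ A' _ hAA'
        exact Set.disjoint_left.2 fun ω h h' => hAA' (h.symm.trans h')
    _ ≤ ENNReal.ofReal (1 - P) ^ m := mul_le_of_le_one_left' prob_le_one

theorem coinLaw_subset_survivors (i : ℕ) (B : Finset (Fin n)) :
    coinLaw n {ω | B ⊆ survivors P i ω} = ENNReal.ofReal (P ^ i) ^ B.card := by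
  have := coinLaw_forall_mem (n := n) (B ×ˢ Finset.range i) (t := Set.Iic P) measurableSet_Iic
  rw [unitInterval.volume_Iic, Finset.card_product, Finset.card_range, mul_comm, pow_mul,
    ← ENNReal.ofReal_pow P.2.1] at this
  rw [← this]
  congr 1
  ext ω
  simp only [Set.mem_ofPred_eq, Finset.subset_iff, mem_survivors, Finset.mem_product,
    Finset.mem_range, Set.mem_Iic, Prod.forall, and_imp]
  exact ⟨fun h v j hv => h hv j, fun h v hv j => h v j hv⟩

/-- The size of the `i`-th sample has the exponential moment of a binomial random variable:
`2 ^ #A` is the number of subsets of `A`. -/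
theorem lintegral_two_pow_card_survivors (i : ℕ) :
    ∫⁻ ω, 2 ^ (survivors P i ω).card ∂coinLaw n = (ENNReal.ofReal (P ^ i) + 1) ^ n := by
  classical
  have hmeas : ∀ B : Finset (Fin n),
      MeasurableSet {ω : Fin n × ℕ → unitInterval | B ⊆ survivors P i ω} := fun B => by
    simp only [Finset.subset_iff, Set.ofPred_forall]
    exact MeasurableSet.iInter fun v => MeasurableSet.iInter fun _ =>
      measurableSet_mem_survivors i v
  have h : ∀ ω : Fin n × ℕ → unitInterval, (2 : ENNReal) ^ (survivors P i ω).card =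
      ∑ B : Finset (Fin n), {ω | B ⊆ survivors P i ω}.indicator 1 ω := fun ω => by
    simp only [Set.indicator_apply, Set.mem_ofPred_eq, Pi.one_apply, Finset.sum_boole]
    rw [show (Finset.univ.filter fun B => B ⊆ survivors P i ω) = (survivors P i ω).powerset by
      ext; simp, Finset.card_powerset]
    push_cast
    rfl
  simp only [h]
  rw [lintegral_finsetSum _ fun B _ => measurable_one.indicator (hmeas B)]
  simp only [lintegral_indicator_one (hmeas _), coinLaw_subset_survivors]
  have := Finset.sum_pow_mul_eq_add_pow (ENNReal.ofReal (P ^ i)) 1 (Finset.univ : Finset (Fin n))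
  simpa using this

theorem coinLaw_le_card_survivors (i m : ℕ) :
    coinLaw n {ω | m ≤ (survivors P i ω).card} ≤
      ENNReal.ofReal (Real.exp (n * P ^ i) / 2 ^ m) := by
  have h₁ : (2 : ENNReal) ^ m * coinLaw n {ω | m ≤ (survivors P i ω).card} ≤
      (ENNReal.ofReal (P ^ i) + 1) ^ n := by
    rw [← lintegral_two_pow_card_survivors]
    refine le_trans ?_ (mul_meas_ge_le_lintegral₀ ?_ ((2 : ENNReal) ^ m))
    · refine mul_le_mul_right (measure_mono fun ω h => ?_) _
      change (2 : ENNReal) ^ m ≤ 2 ^ (survivors P i ω).card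
      exact pow_le_pow_right₀ (by norm_num) h
    · exact (measurable_from_top.comp (measurable_card_survivors i)).aemeasurable
  rw [ENNReal.ofReal_div_of_pos (by positivity), ENNReal.le_div_iff_mul_le (by simp) (by simp),
    ENNReal.ofReal_pow (by norm_num), ENNReal.ofReal_ofNat, mul_comm]
  refine h₁.trans ?_
  have hP := pow_nonneg P.2.1 i
  rw [← ENNReal.ofReal_one, ← ENNReal.ofReal_add hP zero_le_one,
    ← ENNReal.ofReal_pow (by positivity)]
  refine ENNReal.ofReal_le_ofReal ?_
  rw [Real.exp_nat_mul]
  exact pow_le_pow_left₀ (by positivity) (Real.add_one_le_exp _) n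

/-- The expected size of a sample. -/
theorem lintegral_card_survivors (i : ℕ) :
    ∫⁻ ω, ((survivors P i ω).card : ENNReal) ∂coinLaw n = n * ENNReal.ofReal (P ^ i) := by
  classical
  have h : ∀ ω : Fin n × ℕ → unitInterval, ((survivors P i ω).card : ENNReal) =
      ∑ v : Fin n, {ω | v ∈ survivors P i ω}.indicator 1 ω := fun ω => by
    simp [Set.indicator_apply]
  simp only [h]
  rw [lintegral_finsetSum _ fun v _ => measurable_one.indicator (measurableSet_mem_survivors i v)]
  simp only [lintegral_indicator_one (measurableSet_mem_survivors i _)]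
  have h' : ∀ v : Fin n, coinLaw n {ω | v ∈ survivors P i ω} = ENNReal.ofReal (P ^ i) := fun v => by
    simpa using coinLaw_subset_survivors (P := P) i {v}
  simp [h']

/-- The expectation of a random variable with geometric tail. -/
theorem lintegral_card_leading_le (hP : (0 : ℝ) < P) (key : Fin n → α)
    (hkey : Function.Injective key) (R : Finset (Fin n)) (i : ℕ) :
    ∫⁻ ω, ((leading key R (survivors P i ω) (survivors P (i + 1) ω)).card : ENNReal) ∂coinLaw n ≤
      ENNReal.ofReal (1 / P) := by
  classical
  set f : (Fin n × ℕ → unitInterval) → ℕ := fun ω =>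
    (leading key R (survivors P i ω) (survivors P (i + 1) ω)).card with hf
  have hfm : Measurable f := measurable_card_leading key R (measurableSet_mem_survivors i)
    (measurableSet_mem_survivors (i + 1))
  have hfn : ∀ ω, f ω ≤ n := fun ω => (Finset.card_le_univ _).trans_eq (by simp)
  have hms : ∀ m, MeasurableSet {ω | m + 1 ≤ f ω} := fun m =>
    measurableSet_le measurable_const hfm
  have h : ∀ ω, (f ω : ENNReal) =
      ∑ m ∈ Finset.range n, {ω | m + 1 ≤ f ω}.indicator 1 ω := fun ω => by
    simp only [Set.indicator_apply, Set.mem_ofPred_eq, Pi.one_apply, Finset.sum_boole]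
    rw [show (Finset.range n).filter (fun m => m + 1 ≤ f ω) = Finset.range (f ω) by
      ext m
      have := hfn ω
      simp only [Finset.mem_filter, Finset.mem_range]
      omega, Finset.card_range]
  have hQ : (0 : ℝ) ≤ 1 - P := sub_nonneg.2 P.2.2
  calc ∫⁻ ω, (f ω : ENNReal) ∂coinLaw n
      = ∑ m ∈ Finset.range n, coinLaw n {ω | m + 1 ≤ f ω} := by
        simp only [h]
        rw [lintegral_finsetSum _ fun m _ => measurable_one.indicator (hms m)]
        simp only [lintegral_indicator_one (hms _)]
    _ ≤ ∑ m ∈ Finset.range n, ENNReal.ofReal ((1 - P) ^ m) := by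
        refine Finset.sum_le_sum fun m _ => ?_
        refine (coinLaw_le_card_leading key hkey R i (m + 1)).trans ?_
        rw [← ENNReal.ofReal_pow hQ]
        refine ENNReal.ofReal_le_ofReal (pow_le_pow_of_le_one hQ ?_ (Nat.le_succ m))
        linarith
    _ = ENNReal.ofReal (∑ m ∈ Finset.range n, (1 - P : ℝ) ^ m) :=
        (ENNReal.ofReal_sum_of_nonneg fun m _ => pow_nonneg hQ m).symm
    _ ≤ ENNReal.ofReal (1 / P) := by
        refine ENNReal.ofReal_le_ofReal ?_
        rw [geom_sum_eq (by linarith), ← neg_div_neg_eq,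
          show -((1 - P : ℝ) - 1) = P by ring]
        have := pow_nonneg hQ n
        gcongr
        linarith

end

section

/-! ### The size of fronts and sketches -/

/-- The probability with which a node joins the next level. -/
def joinProb (n k : ℕ) : unitInterval :=
  ⟨(n : ℝ) ^ (-(1 / (k : ℝ))), by positivity, by
    rcases Nat.eq_zero_or_pos n with rfl | hn
    · rw [Nat.cast_zero]
      exact Real.zero_rpow_le_one _
    · exact Real.rpow_le_one_of_one_le_of_nonpos (by exact_mod_cast hn)
        (neg_nonpos.2 (by positivity))⟩

theorem tzHierarchy_of_lt {n k i : ℕ} (hi : i < k) (ω : Fin n × ℕ → unitInterval) :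
    tzHierarchy n k ω i = survivors (joinProb n k) i ω := by
  classical
  rw [tzHierarchy, if_pos hi]
  ext v
  simp only [Finset.mem_filter, Finset.mem_univ, true_and, mem_survivors]
  rfl

theorem tzHierarchy_of_le {n k i : ℕ} (hi : k ≤ i) (ω : Fin n × ℕ → unitInterval) :
    tzHierarchy n k ω i = ∅ := by
  classical
  rw [tzHierarchy, if_neg (not_lt.2 hi)]

theorem measurableSet_mem_tzHierarchy {n : ℕ} (k i : ℕ) (v : Fin n) :
    MeasurableSet {ω : Fin n × ℕ → unitInterval | v ∈ tzHierarchy n k ω i} := by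
  rcases Nat.lt_or_ge i k with hi | hi
  · simpa only [tzHierarchy_of_lt hi] using measurableSet_mem_survivors i v
  · simp [tzHierarchy_of_le hi]

/-- The bound for the size of one level of a front that holds with high probability. -/
def levelBound (n k c : ℕ) : ℕ := ⌈(2 * c + 12) * ((n : ℝ) ^ (1 / (k : ℝ)) * Real.log n)⌉₊

variable {n k : ℕ} {α : Type*} [LinearOrder α]

theorem one_le_rpow_inv (hn : 2 ≤ n) : 1 ≤ (n : ℝ) ^ (1 / (k : ℝ)) :=
  Real.one_le_rpow (by exact_mod_cast (by omega : 1 ≤ n)) (by positivity)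

theorem joinProb_mul_rpow (hn : 2 ≤ n) : (joinProb n k : ℝ) * (n : ℝ) ^ (1 / (k : ℝ)) = 1 := by
  have : (0 : ℝ) < n := by exact_mod_cast (by omega : 0 < n)
  rw [joinProb, ← Real.rpow_add this, neg_add_cancel, Real.rpow_zero]

theorem joinProb_pos (hn : 2 ≤ n) : (0 : ℝ) < joinProb n k := by
  have : (0 : ℝ) < n := by exact_mod_cast (by omega : 0 < n)
  exact Real.rpow_pos_of_pos this _

theorem one_div_joinProb (hn : 2 ≤ n) : 1 / (joinProb n k : ℝ) = (n : ℝ) ^ (1 / (k : ℝ)) := by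
  rw [div_eq_iff (joinProb_pos hn).ne', mul_comm, joinProb_mul_rpow hn]

/-- The expected size of the last level. -/
theorem mul_joinProb_pow (hn : 2 ≤ n) {i : ℕ} (hi : i + 1 = k) :
    (n : ℝ) * (joinProb n k : ℝ) ^ i = (n : ℝ) ^ (1 / (k : ℝ)) := by
  have h₀ : (0 : ℝ) < n := by exact_mod_cast (by omega : 0 < n)
  have hk : (k : ℝ) ≠ 0 := by
    have : k ≠ 0 := by omega
    exact_mod_cast this
  have h : (joinProb n k : ℝ) ^ k = (n : ℝ)⁻¹ := by
    rw [joinProb, ← Real.rpow_natCast, ← Real.rpow_mul h₀.le, neg_mul, one_div_mul_cancel hk,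
      Real.rpow_neg_one]
  rw [← one_div_joinProb hn, eq_div_iff (joinProb_pos hn).ne', mul_assoc, ← pow_succ, hi, h,
    mul_inv_cancel₀ h₀.ne']

theorem exp_neg_mul_log (hn : 2 ≤ n) (m : ℕ) :
    Real.exp (-(m * Real.log n)) = 1 / (n : ℝ) ^ m := by
  have h₀ : (0 : ℝ) < n := by exact_mod_cast (by omega : 0 < n)
  rw [Real.exp_neg, Real.exp_nat_mul, Real.exp_log h₀, one_div]

theorem le_levelBound (n k c : ℕ) :
    (2 * c + 12) * ((n : ℝ) ^ (1 / (k : ℝ)) * Real.log n) ≤ levelBound n k c := Nat.le_ceil _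

theorem log_two_le_log (hn : 2 ≤ n) : Real.log 2 ≤ Real.log n :=
  Real.log_le_log (by norm_num) (by exact_mod_cast hn)

theorem half_lt_log (hn : 2 ≤ n) : 1 / 2 < Real.log n := by
  have := Real.log_two_gt_d9
  have := log_two_le_log hn
  linarith

theorem levelBound_pos (hn : 2 ≤ n) (c : ℕ) : 0 < levelBound n k c := by
  have h₁ := one_le_rpow_inv (k := k) hn
  have h₂ := half_lt_log hn
  exact Nat.ceil_pos.2 (by positivity)

theorem levelBound_le (hn : 2 ≤ n) (c : ℕ) :
    (levelBound n k c : ℝ) ≤ (4 * c + 24) * ((n : ℝ) ^ (1 / (k : ℝ)) * Real.log n) := by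
  have h₁ := one_le_rpow_inv (k := k) hn
  have h₂ := half_lt_log hn
  have h₃ : 1 / 2 ≤ (n : ℝ) ^ (1 / (k : ℝ)) * Real.log n := by nlinarith
  have h₄ : (0 : ℝ) ≤ c * ((n : ℝ) ^ (1 / (k : ℝ)) * Real.log n) := by positivity
  have := (Nat.ceil_lt_add_one (a := (2 * c + 12) * ((n : ℝ) ^ (1 / (k : ℝ)) * Real.log n))
    (by positivity)).le
  rw [levelBound]
  linarith

theorem coinLaw_levelBound_lt (hn : 2 ≤ n) (key : Fin n → α) (hkey : Function.Injective key)
    (R : Finset (Fin n)) (c : ℕ) {i : ℕ} (hi : i < k) :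
    coinLaw n {ω | levelBound n k c <
      (leading key R (tzHierarchy n k ω i) (tzHierarchy n k ω (i + 1))).card} ≤
      ENNReal.ofReal (1 / (n : ℝ) ^ (c + 4)) := by
  classical
  have hx := one_le_rpow_inv (k := k) hn
  have hL := half_lt_log hn
  have hm := le_levelBound n k c
  rcases Nat.lt_or_ge (i + 1) k with hi' | hi'
  · simp only [tzHierarchy_of_lt hi, tzHierarchy_of_lt hi']
    refine le_trans (measure_mono ?_)
      ((coinLaw_le_card_leading (P := joinProb n k) key hkey R i
        (levelBound n k c)).trans ?_)
    · intro ω h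
      exact Nat.le_of_lt h
    have hQ : (0 : ℝ) ≤ 1 - joinProb n k := sub_nonneg.2 (joinProb n k).2.2
    rw [← ENNReal.ofReal_pow hQ, ← exp_neg_mul_log hn]
    refine ENNReal.ofReal_le_ofReal ((pow_le_pow_left₀ hQ
      (Real.one_sub_le_exp_neg (joinProb n k : ℝ)) _).trans ?_)
    rw [← Real.exp_nat_mul, Real.exp_le_exp, mul_neg, neg_le_neg_iff]
    have h₁ := mul_le_mul_of_nonneg_right hm (joinProb_pos (k := k) hn).le
    have h₂ : (2 * c + 12) * ((n : ℝ) ^ (1 / (k : ℝ)) * Real.log n) * joinProb n k =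
        (2 * c + 12) * Real.log n := by
      rw [show (2 * c + 12) * ((n : ℝ) ^ (1 / (k : ℝ)) * Real.log n) * joinProb n k =
        (2 * c + 12) * Real.log n * (joinProb n k * (n : ℝ) ^ (1 / (k : ℝ))) by ring,
        joinProb_mul_rpow hn, mul_one]
    rw [h₂] at h₁
    push_cast
    have : (0 : ℝ) ≤ c * Real.log n := by positivity
    linarith
  · have hi' : i + 1 = k := by omega
    have hsub : {ω | levelBound n k c <
        (leading key R (tzHierarchy n k ω i) (tzHierarchy n k ω (i + 1))).card} ⊆
        {ω | levelBound n k c ≤ (survivors (joinProb n k) i ω).card} := by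
      intro ω h
      have h := Nat.le_of_lt h
      rw [tzHierarchy_of_lt hi] at h
      exact h.trans (Finset.card_le_card fun w hw => (mem_leading.1 hw).2.1)
    refine (measure_mono hsub).trans ((coinLaw_le_card_survivors i _).trans ?_)
    rw [mul_joinProb_pow hn hi', ← exp_neg_mul_log hn]
    refine ENNReal.ofReal_le_ofReal ?_
    rw [div_le_iff₀ (by positivity), ← Real.exp_log (show (0 : ℝ) < 2 by norm_num),
      ← Real.exp_nat_mul, ← Real.exp_add, Real.exp_le_exp]
    have hlog := Real.log_two_gt_d9
    have h₁ : (2 * c + 12) * ((n : ℝ) ^ (1 / (k : ℝ)) * Real.log n) * (0.69 : ℝ) ≤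
        levelBound n k c * Real.log 2 := mul_le_mul hm (by linarith) (by norm_num) (by positivity)
    set x := (n : ℝ) ^ (1 / (k : ℝ))
    set l := Real.log n
    have h₂ : x ≤ 2 * (x * l) := by nlinarith
    have h₃ : l ≤ x * l := by nlinarith
    have h₄ : (c : ℝ) * l ≤ c * (x * l) := by gcongr
    have h₅ : (0 : ℝ) ≤ c * (x * l) := by positivity
    push_cast
    linarith

theorem lintegral_card_leading_tzHierarchy_le (hn : 2 ≤ n) (key : Fin n → α)
    (hkey : Function.Injective key) (R : Finset (Fin n)) {i : ℕ} (hi : i < k) :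
    ∫⁻ ω, ((leading key R (tzHierarchy n k ω i) (tzHierarchy n k ω (i + 1))).card : ENNReal)
      ∂coinLaw n ≤ ENNReal.ofReal ((n : ℝ) ^ (1 / (k : ℝ))) := by
  rcases Nat.lt_or_ge (i + 1) k with hi' | hi'
  · simp only [tzHierarchy_of_lt hi, tzHierarchy_of_lt hi']
    rw [← one_div_joinProb hn]
    exact lintegral_card_leading_le (joinProb_pos hn) key hkey R i
  · have hi' : i + 1 = k := by omega
    rw [← mul_joinProb_pow hn hi', ENNReal.ofReal_mul (Nat.cast_nonneg n), ENNReal.ofReal_natCast,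
      ← lintegral_card_survivors]
    refine lintegral_mono fun ω => ?_
    rw [tzHierarchy_of_lt hi]
    exact Nat.cast_le.2 (Finset.card_le_card fun w hw => (mem_leading.1 hw).2.1)

namespace CongestNetwork

variable {a : ℕ} (N : CongestNetwork n a)

/-- The nodes that can be reached from `v` by walks with at most `r` edges. -/
def walkBall (r : ℕ) (v : Fin n) : Finset (Fin n) :=
  open Classical in Finset.univ.filter fun w => ∃ p : N.graph.Walk v w, p.length ≤ r

/-- The order in which `v` sees the other nodes by means of walks with at most `r` edges. It does
not depend on the random numbers. -/
def walkKey (r : ℕ) (v w : Fin n) : ℕ ×ₗ ℕ :=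
  toLex (sInf {x | ∃ p : N.graph.Walk v w, p.length ≤ r ∧ N.walkWeight p = x}, N.id w)

theorem walkKey_injective (r : ℕ) (v : Fin n) : Function.Injective (N.walkKey r v) :=
  fun _ _ h => N.id_injective (congrArg Prod.snd (toLex.injective h))

theorem card_prune_walkEntries_le (hk : 1 ≤ k) (ω : Fin n × ℕ → unitInterval) (r : ℕ)
    (v : Fin n) :
    (prune (N.walkEntries (fun v => tzLevel n k fun j => ω (v, j)) r v)).card ≤
      ∑ i ∈ Finset.range k, (leading (N.walkKey r v) (N.walkBall r v)
        (tzHierarchy n k ω i) (tzHierarchy n k ω (i + 1))).card := by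
  classical
  set lv : Fin n → ℕ := fun v => tzLevel n k fun j => ω (v, j)
  have hA : ∀ i v, v ∈ tzHierarchy n k ω i ↔ i < k ∧ i ≤ lv v := fun i v => mem_tzHierarchy
  have hmin : ∀ w ∈ N.walkBall r v, ∃ p : N.graph.Walk v w, p.length ≤ r ∧
      toLex (N.walkWeight p, N.id w) = N.walkKey r v w := fun w hw => by
    obtain ⟨p, hp⟩ := (Finset.mem_filter.1 hw).2
    obtain ⟨q, hq, hqw⟩ := Nat.sInf_mem
      (s := {x | ∃ p : N.graph.Walk v w, p.length ≤ r ∧ N.walkWeight p = x}) ⟨_, p, hp, rfl⟩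
    exact ⟨q, hq, by rw [walkKey, hqw]⟩
  have hsub : prune (N.walkEntries lv r v) ⊆ (Finset.range k).biUnion fun i =>
      (leading (N.walkKey r v) (N.walkBall r v) (tzHierarchy n k ω i)
        (tzHierarchy n k ω (i + 1))).image fun w =>
          ⟨lv w, (ofLex (N.walkKey r v w)).1, N.id w⟩ := by
    intro e he
    obtain ⟨he, hpar⟩ := mem_prune.1 he
    obtain ⟨w, p, hp, rfl⟩ := N.mem_walkEntries.1 he
    have hw : w ∈ N.walkBall r v := Finset.mem_filter.2 ⟨Finset.mem_univ _, p, hp⟩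
    have hdom : ∀ w' ∈ N.walkBall r v, lv w < lv w' ∨ w' = w →
        N.walkKey r v w' ≤ toLex (N.walkWeight p, N.id w) →
        (⟨lv w', (ofLex (N.walkKey r v w')).1, N.id w'⟩ : TZEntry) =
          ⟨lv w, N.walkWeight p, N.id w⟩ := by
      intro w' hw' hor hle
      obtain ⟨q, hq, hqw⟩ := hmin w' hw'
      rw [← hqw] at hle ⊢
      refine hpar _ (N.mem_walkEntries.2 ⟨w', q, hq, rfl⟩) ⟨hle, hor.imp_right ?_⟩
      rintro rfl
      exact ⟨rfl, rfl⟩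
    have hkey : (N.walkKey r v w) ≤ toLex (N.walkWeight p, N.id w) :=
      Prod.Lex.toLex_mono ⟨Nat.sInf_le ⟨p, hp, rfl⟩, le_rfl⟩
    refine Finset.mem_biUnion.2 ⟨lv w, Finset.mem_range.2 (tzLevel_lt hk _),
      Finset.mem_image.2 ⟨w, mem_leading.2 ⟨hw, (hA _ _).2 ⟨tzLevel_lt hk _, le_rfl⟩, ?_⟩,
        hdom w hw (Or.inr rfl) hkey⟩⟩
    intro w' hw' hw'A
    by_contra hcon
    have hlt := ((hA _ _).1 hw'A).2
    have := congrArg TZEntry.level (hdom w' hw' (Or.inl hlt) ((not_lt.1 hcon).trans hkey))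
    dsimp only at this
    omega
  exact (Finset.card_le_card hsub).trans (Finset.card_biUnion_le.trans
    (Finset.sum_le_sum fun i _ => Finset.card_image_le))

/-- With high probability, all fronts that occur in the course of the algorithm are small. -/
theorem coinLaw_not_small_fronts (hn : 2 ≤ n) (hk : 1 ≤ k) (c : ℕ) :
    coinLaw n {ω | ¬ ∀ r ≤ n, ∀ v,
      (prune (N.walkEntries (fun v => tzLevel n k fun j => ω (v, j)) r v)).card ≤
        k * levelBound n k c} ≤ ENNReal.ofReal (1 / (n : ℝ) ^ c) := by
  classical
  have hpos := levelBound_pos (k := k) hn c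
  rcases Nat.lt_or_ge n k with hnk | hnk
  -- With more levels than nodes, the bound exceeds the number of nodes.
  · convert zero_le (a := ENNReal.ofReal (1 / (n : ℝ) ^ c))
    rw [show {ω | _} = (∅ : Set (Fin n × ℕ → unitInterval)) from ?_, measure_empty]
    refine Set.eq_empty_of_forall_notMem fun ω h => h fun r _ v => ?_
    refine (card_prune_le (fun v => tzLevel n k fun j => ω (v, j)) N.id (fun e he => ?_) N.id_injective).trans
      (hnk.le.trans (Nat.le_mul_of_pos_right k hpos))
    obtain ⟨w, p, -, rfl⟩ := N.mem_walkEntries.1 he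
    exact ⟨w, rfl, rfl⟩
  let I : Finset (ℕ × Fin n × ℕ) :=
    Finset.range (n + 1) ×ˢ Finset.univ ×ˢ Finset.range k
  have hsub : {ω | ¬ ∀ r ≤ n, ∀ v,
      (prune (N.walkEntries (fun v => tzLevel n k fun j => ω (v, j)) r v)).card ≤
        k * levelBound n k c} ⊆
      ⋃ x ∈ I, {ω | levelBound n k c < (leading (N.walkKey x.1 x.2.1) (N.walkBall x.1 x.2.1)
        (tzHierarchy n k ω x.2.2) (tzHierarchy n k ω (x.2.2 + 1))).card} := by
    intro ω hω
    by_contra hcon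
    refine hω fun r hr v => (N.card_prune_walkEntries_le hk ω r v).trans ?_
    refine (Finset.sum_le_card_nsmul _ _ (levelBound n k c) fun i hi => ?_).trans_eq
      (by rw [Finset.card_range, smul_eq_mul])
    by_contra h
    refine hcon (Set.mem_iUnion₂.2 ⟨(r, v, i), ?_, not_le.1 h⟩)
    simp only [I, Finset.mem_product, Finset.mem_range, Finset.mem_univ, true_and]
    exact ⟨by omega, Finset.mem_range.1 hi⟩
  have hI : I.card ≤ n ^ 4 := by
    simp only [I, Finset.card_product, Finset.card_range, Finset.card_univ, Fintype.card_fin]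
    calc (n + 1) * (n * k) ≤ n ^ 2 * (n * n) := by
          gcongr
          nlinarith
      _ = n ^ 4 := by ring
  have h₀ : (0 : ℝ) < n := by exact_mod_cast (by omega : 0 < n)
  calc _ ≤ _ := measure_mono hsub
    _ ≤ ∑ x ∈ I, coinLaw n {ω | levelBound n k c <
        (leading (N.walkKey x.1 x.2.1) (N.walkBall x.1 x.2.1)
        (tzHierarchy n k ω x.2.2) (tzHierarchy n k ω (x.2.2 + 1))).card} :=
        measure_biUnion_finset_le _ _
    _ ≤ I.card • ENNReal.ofReal (1 / (n : ℝ) ^ (c + 4)) := by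
        refine Finset.sum_le_card_nsmul _ _ _ fun x hx => ?_
        refine coinLaw_levelBound_lt hn _ (N.walkKey_injective _ _) _ c ?_
        simp only [I, Finset.mem_product, Finset.mem_range] at hx
        exact hx.2.2
    _ ≤ ENNReal.ofReal (1 / (n : ℝ) ^ c) := by
        rw [← ENNReal.ofReal_nsmul]
        refine ENNReal.ofReal_le_ofReal ?_
        have : (I.card : ℝ) ≤ (n : ℝ) ^ 4 := by exact_mod_cast hI
        rw [nsmul_eq_mul]
        calc (I.card : ℝ) * (1 / (n : ℝ) ^ (c + 4))
            ≤ (n : ℝ) ^ 4 * (1 / (n : ℝ) ^ (c + 4)) := by gcongr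
          _ = 1 / (n : ℝ) ^ c := by field_simp; ring

theorem card_bunch_le (ω : Fin n × ℕ → unitInterval) (u : Fin n) :
    (N.tzLabel k ω u).bunch.card ≤ ∑ i ∈ Finset.range k,
      (leading (fun w => toLex (N.wdist u w, N.id w)) Finset.univ
        (tzHierarchy n k ω i) (tzHierarchy n k ω (i + 1))).card := by
  classical
  refine Finset.card_biUnion_le.trans (Finset.sum_le_sum fun i _ => ?_)
  refine (Finset.card_le_card (t := (leading (fun w => toLex (N.wdist u w, N.id w)) Finset.univ
    (tzHierarchy n k ω i) (tzHierarchy n k ω (i + 1))).image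
      fun w => toLex (N.wdist u w, N.id w)) fun x hx => ?_).trans Finset.card_image_le
  obtain ⟨w, hw, rfl, hlt⟩ := N.mem_closerEntries.1 hx
  exact Finset.mem_image.2
    ⟨w, mem_leading.2 ⟨Finset.mem_univ w, hw, fun w' _ hw' => hlt w' hw'⟩, rfl⟩

theorem words_le (ω : Fin n × ℕ → unitInterval) (u : Fin n) :
    (N.tzLabel k ω u).words ≤ 2 * k + 2 * (N.tzLabel k ω u).bunch.card := by
  classical
  have : (Finset.univ.filter fun i => (N.tzLabel k ω u).pivot i ≠ ⊤).card ≤ k :=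
    (Finset.card_le_univ _).trans_eq (by simp)
  unfold DistSketch.words
  convert Nat.add_le_add_right (Nat.mul_le_mul_left 2 this) _

theorem lintegral_words_le (hn : 2 ≤ n) (u : Fin n) :
    ∫⁻ ω, ((N.tzLabel k ω u).words : ENNReal) ∂coinLaw n ≤
      ENNReal.ofReal (4 * (k * (n : ℝ) ^ (1 / (k : ℝ)))) := by
  have hx := one_le_rpow_inv (k := k) hn
  let f : ℕ → (Fin n × ℕ → unitInterval) → ℕ := fun i ω =>
    (leading (fun w => toLex (N.wdist u w, N.id w)) Finset.univ
      (tzHierarchy n k ω i) (tzHierarchy n k ω (i + 1))).card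
  have hkey : Function.Injective fun w => toLex (N.wdist u w, N.id w) :=
    fun _ _ h => N.id_injective (congrArg Prod.snd (toLex.injective h))
  have hf : ∀ i, Measurable fun ω => (f i ω : ENNReal) := fun i =>
    measurable_from_top.comp (measurable_card_leading _ _ (measurableSet_mem_tzHierarchy k i)
      (measurableSet_mem_tzHierarchy k (i + 1)))
  calc ∫⁻ ω, ((N.tzLabel k ω u).words : ENNReal) ∂coinLaw n
      ≤ ∫⁻ ω, (2 * k + 2 * ∑ i ∈ Finset.range k, (f i ω : ENNReal)) ∂coinLaw n := by
        refine lintegral_mono fun ω => ?_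
        have h : (N.tzLabel k ω u).words ≤ 2 * k + 2 * ∑ i ∈ Finset.range k, f i ω :=
          (N.words_le ω u).trans
            (Nat.add_le_add_left (Nat.mul_le_mul_left 2 (N.card_bunch_le ω u)) _)
        refine (Nat.cast_le.2 h).trans_eq ?_
        push_cast
        rfl
    _ = 2 * k + 2 * ∑ i ∈ Finset.range k, ∫⁻ ω, (f i ω : ENNReal) ∂coinLaw n := by
        rw [lintegral_add_left measurable_const, lintegral_const, measure_univ, mul_one,
          lintegral_const_mul' _ _ (by simp), lintegral_finsetSum _ fun i _ => hf i]
    _ ≤ 2 * k + 2 * ∑ i ∈ Finset.range k, ENNReal.ofReal ((n : ℝ) ^ (1 / (k : ℝ))) := by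
        gcongr with i hi
        exact lintegral_card_leading_tzHierarchy_le hn _ hkey _ (Finset.mem_range.1 hi)
    _ = ENNReal.ofReal (2 * k + 2 * (k * (n : ℝ) ^ (1 / (k : ℝ)))) := by
        rw [Finset.sum_const, Finset.card_range, nsmul_eq_mul,
          ENNReal.ofReal_add (by positivity) (by positivity), ENNReal.ofReal_mul (by norm_num),
          ENNReal.ofReal_mul (by norm_num), ENNReal.ofReal_mul (by positivity)]
        simp
    _ ≤ ENNReal.ofReal (4 * (k * (n : ℝ) ^ (1 / (k : ℝ)))) := by
        refine ENNReal.ofReal_le_ofReal ?_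
        have : (k : ℝ) * 1 ≤ k * (n : ℝ) ^ (1 / (k : ℝ)) := by gcongr
        linarith

end CongestNetwork

end

/-! ### Stretch -/

/-- The entries (distance, identifier) that occur in a sketch. -/
def DistSketch.Mem {k : ℕ} (L : DistSketch k) (d x : ℕ) : Prop :=
  (∃ i, L.pivot i = (toLex (d, x) : ℕ ×ₗ ℕ)) ∨ toLex (d, x) ∈ L.bunch

/-- The distance estimate: the shortest way via a node that occurs in both sketches. -/
def distEstimate {k : ℕ} (L L' : DistSketch k) : ℕ :=
  sInf {s | ∃ d d' x, L.Mem d x ∧ L'.Mem d' x ∧ d + d' = s}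

namespace CongestNetwork

variable {n a k : ℕ} (N : CongestNetwork n a)

theorem exists_of_mem_tzLabel {ω : Fin n × ℕ → unitInterval} {u : Fin n} {d x : ℕ}
    (h : (N.tzLabel k ω u).Mem d x) : ∃ w, N.wdist u w = d ∧ N.id w = x := by
  classical
  rcases h with ⟨i, h⟩ | h
  · obtain ⟨w, -, hw⟩ := N.mem_entries.1 (Finset.mem_of_min h)
    exact ⟨w, congrArg Prod.fst (toLex.injective hw), congrArg Prod.snd (toLex.injective hw)⟩
  · obtain ⟨i, -, h⟩ := Finset.mem_biUnion.1 h
    obtain ⟨w, -, hw, -⟩ := N.mem_closerEntries.1 h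
    exact ⟨w, congrArg Prod.fst (toLex.injective hw), congrArg Prod.snd (toLex.injective hw)⟩

/-- The search for a common node: the pivots of `u` and `v` on levels `0, 1, …` are tried
alternately, and each failure increases the distance by at most the distance of `u` and `v`. -/
theorem exists_common_mem (ω : Fin n × ℕ → unitInterval) (D : ℕ) (m i : ℕ) (hm : i + m + 1 = k)
    (u v w : Fin n) (hD : N.wdist u v = D)
    (hw : (N.tzLabel k ω u).pivot ⟨i, by omega⟩ = (toLex (N.wdist u w, N.id w) : ℕ ×ₗ ℕ))
    (hwA : w ∈ tzHierarchy n k ω i) (hd : N.wdist u w ≤ i * D) :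
    ∃ x, (N.tzLabel k ω u).Mem (N.wdist u x) (N.id x) ∧
      (N.tzLabel k ω v).Mem (N.wdist v x) (N.id x) ∧
      N.wdist u x + N.wdist v x ≤ (2 * k - 1) * D := by
  classical
  have hvw : N.wdist v w ≤ (i + 1) * D := by
    have := N.wdist_triangle v u w
    rw [N.wdist_comm v u, hD] at this
    linarith
  by_cases hB : toLex (N.wdist v w, N.id w) ∈
      N.closerEntries v (tzHierarchy n k ω i) (tzHierarchy n k ω (i + 1))
  · refine ⟨w, Or.inl ⟨_, hw⟩, Or.inr (Finset.mem_biUnion.2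
      ⟨i, Finset.mem_range.2 (by omega), hB⟩), ?_⟩
    calc N.wdist u w + N.wdist v w ≤ i * D + (i + 1) * D := add_le_add hd hvw
      _ = (2 * i + 1) * D := by ring
      _ ≤ (2 * k - 1) * D := Nat.mul_le_mul_right _ (by omega)
  · obtain ⟨w', hw', hle⟩ : ∃ w' ∈ tzHierarchy n k ω (i + 1),
        toLex (N.wdist v w', N.id w') ≤ toLex (N.wdist v w, N.id w) := by
      by_contra! hcon
      exact hB (N.mem_closerEntries.2 ⟨w, hwA, rfl, hcon⟩)
    have hik : i + 1 < k := (mem_tzHierarchy.1 hw').1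
    obtain ⟨y, hy⟩ := Finset.min_of_mem (N.mem_entries.2 ⟨w', hw', rfl⟩)
    obtain ⟨z, hz, rfl⟩ := N.mem_entries.1 (Finset.mem_of_min hy)
    have hzw : toLex (N.wdist v z, N.id z) ≤ toLex (N.wdist v w, N.id w) :=
      (WithTop.coe_le_coe.1 (hy ▸ Finset.min_le (N.mem_entries.2 ⟨w', hw', rfl⟩))).trans hle
    have hzd : N.wdist v z ≤ (i + 1) * D := by
      rw [Prod.Lex.toLex_le_toLex] at hzw
      simp only at hzw
      omega
    obtain _ | m := m
    · omega
    obtain ⟨x, hx, hx', hle⟩ := exists_common_mem ω D m (i + 1) (by omega) v u z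
      ((N.wdist_comm v u).trans hD) hy hz hzd
    exact ⟨x, hx', hx, (add_comm _ _).trans_le hle⟩

theorem wdist_le_distEstimate_and_le (hk : 1 ≤ k) (ω : Fin n × ℕ → unitInterval) (u v : Fin n) :
    N.wdist u v ≤ distEstimate (N.tzLabel k ω u) (N.tzLabel k ω v) ∧
      distEstimate (N.tzLabel k ω u) (N.tzLabel k ω v) ≤ (2 * k - 1) * N.wdist u v := by
  have hu : u ∈ tzHierarchy n k ω 0 := mem_tzHierarchy.2 ⟨hk, Nat.zero_le _⟩
  obtain ⟨y, hy⟩ := Finset.min_of_mem (N.mem_entries.2 ⟨u, hu, rfl⟩)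
  obtain ⟨z, hz, rfl⟩ := N.mem_entries.1 (Finset.mem_of_min hy)
  have hzd : N.wdist u z ≤ 0 * N.wdist u v := by
    have h : toLex (N.wdist u z, N.id z) ≤ toLex (N.wdist u u, N.id u) :=
      WithTop.coe_le_coe.1 (hy ▸ Finset.min_le (N.mem_entries.2 ⟨u, hu, rfl⟩))
    rw [Prod.Lex.toLex_le_toLex, N.wdist_self] at h
    simp only at h
    omega
  obtain ⟨x, hx, hx', hle⟩ := N.exists_common_mem ω _ (k - 1) 0 (by omega) u v z rfl hy hz hzd
  have hmem : N.wdist u x + N.wdist v x ∈ {s | ∃ d d' x, (N.tzLabel k ω u).Mem d x ∧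
      (N.tzLabel k ω v).Mem d' x ∧ d + d' = s} := ⟨_, _, _, hx, hx', rfl⟩
  refine ⟨?_, (Nat.sInf_le hmem).trans hle⟩
  obtain ⟨d, d', y, hd, hd', hs⟩ := Nat.sInf_mem ⟨_, hmem⟩
  rw [distEstimate, ← hs]
  obtain ⟨w, rfl, rfl⟩ := N.exists_of_mem_tzLabel hd
  obtain ⟨w', rfl, hww'⟩ := N.exists_of_mem_tzLabel hd'
  obtain rfl := N.id_injective hww'
  rw [N.wdist_comm v]
  exact N.wdist_triangle _ _ _

end CongestNetwork

end

theorem mainTheorem1 :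
    -- `c` is the exponent in "with high probability", `C` the constant hidden in the bounds
    ∀ c : ℕ, ∃ C : ℝ, 0 < C ∧
    -- identifiers and weights are at most `n ^ a`, and messages have `b * ⌈log₂ n⌉` bits
    ∀ a : ℕ, ∃ b : ℕ,
    ∀ k : ℕ, 1 ≤ k →
    -- the distance estimate is a function of the two sketches alone
    ∃ est : DistSketch k → DistSketch k → ℕ,
    ∀ n : ℕ, 2 ≤ n →
    ∃ alg : CongestAlgorithm (b * Nat.clog 2 n) (DistSketch k),
    ∀ N : CongestNetwork n a,
      -- almost surely every node halts with its Thorup-Zwick label as output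
      (∀ᵐ ω ∂coinLaw n, ∃ T : ℕ, ∀ v, alg.outputAt N ω T v = some (N.tzLabel k ω v)) ∧
      -- with high probability: rounds, messages, and sketch sizes
      coinLaw n {ω | ¬ ((∃ T : ℕ,
            (T : ℝ) ≤ C * (k * (n : ℝ) ^ (1 / (k : ℝ)) * N.shortestPathDiameter * Real.log n) ∧
            (alg.messagesUpTo N ω T : ℝ) ≤
              C * (k * (n : ℝ) ^ (1 / (k : ℝ)) * N.shortestPathDiameter * N.numEdges *
                Real.log n) ∧
            ∀ v, alg.outputAt N ω T v = some (N.tzLabel k ω v)) ∧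
          ∀ v, ((N.tzLabel k ω v).words : ℝ) ≤
            C * (k * (n : ℝ) ^ (1 / (k : ℝ)) * Real.log n))} ≤
        ENNReal.ofReal (1 / (n : ℝ) ^ c) ∧
      -- expected sketch size
      (∀ v, ∫⁻ ω, ((N.tzLabel k ω v).words : ENNReal) ∂coinLaw n ≤
        ENNReal.ofReal (C * (k * (n : ℝ) ^ (1 / (k : ℝ))))) ∧
      -- stretch
      (∀ ω u v, N.wdist u v ≤ est (N.tzLabel k ω u) (N.tzLabel k ω v) ∧
        (est (N.tzLabel k ω u) (N.tzLabel k ω v) : ℝ) ≤ (2 * (k : ℝ) - 1) * N.wdist u v) := by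
  intro c
  refine ⟨40 * c + 240, by positivity, fun a => ⟨2 * a + 14, fun k hk =>
    ⟨distEstimate, fun n hn => ?_⟩⟩⟩
  -- A phase has room for `levelBound n k c` entries on each of the `k` levels.
  have hm := levelBound_pos (k := k) hn c
  have hK : 0 < k * levelBound n k c := Nat.mul_pos hk hm
  obtain ⟨code⟩ := nonempty_phaseCode (a := a) hn hK (Nat.le_mul_of_pos_right k hm)
  refine ⟨(tzAlgorithm n k (n ^ a)).toCongest code, fun N => ⟨?_, ?_, fun v => ?_, ?_⟩⟩
  · refine Filter.Eventually.of_forall fun ω => ?_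
    have hS := N.shortestPathDiameter_le
    obtain ⟨i, -, hout⟩ := CongestNetwork.exists_outputAt_eq hn hk hK code ω (by omega)
      (CongestNetwork.stopped_of_large_phases (N := N) (fun v => tzLevel_lt hk _))
    exact ⟨_, hout⟩
  · refine (measure_mono ?_).trans (N.coinLaw_not_small_fronts hn hk c)
    intro ω hω hsmall
    refine hω ⟨?_, fun v => ?_⟩
    -- A table has at most `k * levelBound n k c ≤ k * (4 * c + 24) * n ^ (1 / k) * log n` entries,
    -- there are at most `5 * S` phases, and each round costs at most `2 * |E|` messages.
    all_goals
      have hmK := levelBound_le (k := k) hn c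
      have hx := one_le_rpow_inv (k := k) hn
      have hL := half_lt_log hn
      set x := (n : ℝ) ^ (1 / (k : ℝ))
      set l := Real.log n
    · obtain ⟨T, hT, hout⟩ := CongestNetwork.exists_outputAt_eq_of_small_fronts hn hk hK code ω
        hsmall
      have hT' : (T : ℝ) ≤ (20 * c + 120) * (k * x * N.shortestPathDiameter * l) := by
        calc (T : ℝ) ≤ 5 * N.shortestPathDiameter * (k * levelBound n k c) := by exact_mod_cast hT
          _ ≤ 5 * N.shortestPathDiameter * (k * ((4 * c + 24) * (x * l))) := by gcongr
          _ = (20 * c + 120) * (k * x * N.shortestPathDiameter * l) := by ring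
      refine ⟨T, hT'.trans ?_, ?_, hout⟩
      · gcongr <;> norm_num
      · calc _ ≤ (T : ℝ) * (2 * N.numEdges) := by
              exact_mod_cast CongestAlgorithm.messagesUpTo_le _ N ω T
          _ ≤ (20 * c + 120) * (k * x * N.shortestPathDiameter * l) * (2 * N.numEdges) := by gcongr
          _ = (40 * c + 240) * (k * x * N.shortestPathDiameter * N.numEdges * l) := by ring
    · have hw : (N.tzLabel k ω v).words ≤ 4 * (k * levelBound n k c) := by
        have hb : (N.tzLabel k ω v).bunch.card ≤ k * levelBound n k c := by
          rw [← N.sketchOf_prune_distEntries hk ω v]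
          refine Finset.card_image_le.trans ?_
          rw [← CongestNetwork.prune_walkEntries N.shortestPathDiameter_le]
          exact hsmall n le_rfl v
        have := N.words_le (k := k) ω v
        have := Nat.le_mul_of_pos_right k hm
        omega
      calc ((N.tzLabel k ω v).words : ℝ) ≤ 4 * (k * levelBound n k c) := by exact_mod_cast hw
        _ ≤ 4 * (k * ((4 * c + 24) * (x * l))) := by gcongr
        _ = (16 * c + 96) * (k * x * l) := by ring
        _ ≤ (40 * c + 240) * (k * x * l) := by gcongr <;> norm_num
  · refine (N.lintegral_words_le hn v).trans (ENNReal.ofReal_le_ofReal ?_)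
    have : (0 : ℝ) ≤ c := Nat.cast_nonneg c
    gcongr
    linarith
  · intro ω u v
    obtain ⟨h₁, h₂⟩ := N.wdist_le_distEstimate_and_le hk ω u v
    refine ⟨h₁, ?_⟩
    have h₃ : ((2 * k - 1 : ℕ) : ℝ) = 2 * (k : ℝ) - 1 := by
      rw [Nat.cast_sub (by omega)]
      push_cast
      ring
    rw [← h₃]
    exact_mod_cast h₂
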